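/- Let $G$ be a locally compact (Hausdorff) IN group, i.e. there is a compact neighborhood $Q_0$ of $e$ with $xQ_0=Q_0x$ for all $x\in G$. Fix a left Haar measure on $G$ and let $\Delta$ be the modular function. Let $\pi$ be an irreducible (strongly continuous) unitary representation of $G$ on a Hilbert space $\mathcal H$, and write $V_gf(x)=\langle f,\pi(x)g\rangle$ for $f,g\in\mathcal H$. Put $L_xF(y)=F(x^{-1}y)$ and $R_xF(y)=F(yx)$. Let $Q$ be any measurable relatively compact neighborhood of $e$. For a weight $m$ and $0<p\le 1$, $L^p_m$ is the space of measurable $F$ with $Fm\in L^p(G)$, quasi-normed by $\|F|L^p_m\|=\|Fm\|_{L^p}$, and $W(L^\infty,L^p_m)$ is the space of $F\in L^\infty_{loc}(G)$ with $K(F)\in L^p_m$, where $K(F)(x)=\|\chi_{xQ}F\|_{L^\infty}$, quasi-normed by $\|K(F)|L^p_m\|$. Operator quasi-norms on it are denoted $|||\cdot|W(L^\infty,L^p_m)|||$. Set $$\mathbb B^p_m=\{g\in\mathcal H: V_gg\in L^2(G),\ V_gg\in W(L^\infty,L^p_m)\},\qquad \mathbb A_m=\{g\in\mathcal H: V_gg\in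 L^1_m\}.$$ Let $0<p\le 1$ and let $w$ be a submultiplicative weight on $G$, i.e. $w$ is continuous, positive and $w(xy)\le w(x)w(y)$, such that $\mathbb B^p_w\neq\{0\}$. Put $w^\bullet(x)=\max\{w(x),w(x^{-1})\}$ and $Y=L^p_{w^\bullet}$. Then: 1. $w^\bullet\ge 1$, and all left and right translations are bounded operators on $W(L^\infty,Y)$. With $$w_Y(x)=\max\{|||R_x|W(L^\infty,Y)|||,\ \Delta(x^{-1})\,|||R_{x^{-1}}|W(L^\infty,Y)|||\},\quad v(x)=\max\{1,|||L_{x^{-1}}|W(L^\infty,Y)|||\},$$ the set $\mathbb B(Y)=\mathbb B^p_{w_Y}\cap\mathbb A_v$ contains a non-zero vector. 2. $\mathbb B^p_w=\mathbb B^p_{w^\bullet}$. 3. $\mathbb B^p_{w^\bullet}=\mathcal C(L^p_{w^\bullet})$ in the following sense. Let $g_0\in\mathbb A_v\setminus\{0\}$ and $g\in\mathbb B(Y)\setminus\{0\}$ be arbitrary. Let $\mathcal H^1_v=\{h\in\mathcal H: V_{g_0}h\in L^1_v\}$ with norm $\|V_{g_0}h|L^1_v\|$, and let $(\mathcal H^1_v)^\urcorner$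 be the space of its bounded conjugate-linear functionals. Then the map $u\mapsto\langle u,\cdot\rangle$ from $\mathcal H$ to the conjugate-linear functionals on $\mathcal H^1_v$ is injective, $\pi(x)g\in\mathcal H^1_v$ for all $x\in G$, and the image of $\mathbb B^p_{w^\bullet}$ under this map is exactly the coorbit space $$\mathcal C(L^p_{w^\bullet})=\{f\in(\mathcal H^1_v)^\urcorner:\ V_gf\in W(L^\infty,L^p_{w^\bullet})\},\qquad V_gf(x)=\langle f,\pi(x)g\rangle=f(\pi(x)g).$$ -/

import Mathlib

open MeasureTheory
open scoped NNReal ENNReal Topology Pointwise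

noncomputable section

namespace CoorbitTheory

/-- `G` is an IN group: there is a compact neighbourhood `Q` of the identity with `xQ = Qx`
for all `x`. -/
def IsINGroup (G : Type*) [Group G] [TopologicalSpace G] : Prop :=
  ∃ Q : Set G, IsCompact Q ∧ Q ∈ 𝓝 (1 : G) ∧
    ∀ x : G, (fun q => x * q) '' Q = (fun q => q * x) '' Q

/-- A submultiplicative weight: a positive continuous function with `w (xy) ≤ w x * w y`. -/
structure IsSubmulWeight {G : Type*} [Group G] [TopologicalSpace G] (w : G → ℝ≥0) : Prop where
  pos : ∀ x, 0 < w x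
  continuous : Continuous w
  submul : ∀ x y, w (x * y) ≤ w x * w y

/-- The symmetrized weight `x ↦ max (w x) (w x⁻¹)`. -/
def bullet {G : Type*} [Group G] (w : G → ℝ≥0) (x : G) : ℝ≥0 := max (w x) (w x⁻¹)

/-- Left translation `L_x F (y) = F (x⁻¹ y)`. -/
def leftTrans {G : Type*} [Group G] (x : G) (F : G → ℂ) : G → ℂ := fun y => F (x⁻¹ * y)

/-- Right translation `R_x F (y) = F (y x)`. -/
def rightTrans {G : Type*} [Group G] (x : G) (F : G → ℂ) : G → ℂ := fun y => F (y * x)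

/-- A measurable relatively compact neighbourhood of the identity. -/
structure IsWindow {G : Type*} [Group G] [TopologicalSpace G] [MeasurableSpace G]
    (Q : Set G) : Prop where
  measurableSet : MeasurableSet Q
  mem_nhds : Q ∈ 𝓝 (1 : G)
  relCompact : IsCompact (closure Q)

section WeightedLp

variable {G : Type*} [MeasurableSpace G]

/-- Membership in the weighted space `L^p_w`, for complex valued or `[0,∞]`-valued functions:
`w F ∈ L^p`. -/
def MemWLp {ε : Type*} [TopologicalSpace ε] [ContinuousENorm ε] [SMul ℝ≥0 ε] (μ : Measure G)
    (w : G → ℝ≥0) (p : ℝ≥0∞) (F : G → ε) : Prop :=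
  MemLp (fun x => w x • F x) p μ

/-- The quasi-norm of `L^p_w` (infinite outside the space). -/
def wLpNorm {ε : Type*} [ENorm ε] [SMul ℝ≥0 ε] (μ : Measure G)
    (w : G → ℝ≥0) (p : ℝ≥0∞) (F : G → ε) : ℝ≥0∞ :=
  eLpNorm (fun x => w x • F x) p μ

end WeightedLp

section Amalgam

variable {G : Type*} [Group G] [TopologicalSpace G] [MeasurableSpace G]

/-- The control function `K(F,Q,L^∞)(x) = ‖χ_{xQ} F‖_∞`. -/
def controlFn (μ : Measure G) (Q : Set G) (F : G → ℂ) (x : G) : ℝ≥0∞ :=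
  eLpNorm F ∞ (μ.restrict (x • Q))

/-- `F` is locally in `L^∞`. -/
def LocLinfty (μ : Measure G) (F : G → ℂ) : Prop :=
  ∀ C : Set G, IsCompact C → MemLp F ∞ (μ.restrict C)

/-- Membership in the Wiener amalgam space `W(L^∞, L^p_w, Q)`. -/
def MemAmalgam (μ : Measure G) (Q : Set G) (w : G → ℝ≥0) (p : ℝ≥0∞) (F : G → ℂ) : Prop :=
  LocLinfty μ F ∧ MemWLp μ w p (controlFn μ Q F)

/-- The quasi-norm of `W(L^∞, L^p_w, Q)`. -/
def amalgamNorm (μ : Measure G) (Q : Set G) (w : G → ℝ≥0) (p : ℝ≥0∞) (F : G → ℂ) : ℝ≥0∞ :=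
  wLpNorm μ w p (controlFn μ Q F)

/-- The operator quasi-norm `|||T | W(L^∞, L^p_w, Q)|||` (infinite if `T` is unbounded). -/
def opNorm (μ : Measure G) (Q : Set G) (w : G → ℝ≥0) (p : ℝ≥0∞)
    (T : (G → ℂ) → (G → ℂ)) : ℝ≥0∞ :=
  sInf {C : ℝ≥0∞ | ∀ F, MemAmalgam μ Q w p F →
    amalgamNorm μ Q w p (T F) ≤ C * amalgamNorm μ Q w p F}

/-- `T` is a bounded operator of `W(L^∞, L^p_w, Q)` into itself. -/
def BoundedOnAmalgam (μ : Measure G) (Q : Set G) (w : G → ℝ≥0) (p : ℝ≥0∞)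
    (T : (G → ℂ) → (G → ℂ)) : Prop :=
  (∀ F, MemAmalgam μ Q w p F → MemAmalgam μ Q w p (T F)) ∧ opNorm μ Q w p T < ∞

/-- The Haar modulus `Δ`, normalized by `μ (A x) = Δ x * μ A` for left Haar measure `μ`.
Mathlib's modular character is `x ↦ μ (A x⁻¹) / μ A`, whence the inverse. -/
def modulus [IsTopologicalGroup G] [LocallyCompactSpace G] (x : G) : ℝ≥0 :=
  Measure.modularCharacterFun x⁻¹

/-- For `Y = L^p_m`, the weight
`x ↦ max {|||R_x | W(L^∞,Y)|||, Δ(x⁻¹) |||R_{x⁻¹} | W(L^∞,Y)|||}`. It is only used when the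
translations are bounded, so that the maximum is finite. -/
def rightWeight [IsTopologicalGroup G] [LocallyCompactSpace G] (μ : Measure G) (Q : Set G)
    (m : G → ℝ≥0) (p : ℝ≥0∞) (x : G) : ℝ≥0 :=
  (max (opNorm μ Q m p (rightTrans x))
    (modulus x⁻¹ * opNorm μ Q m p (rightTrans x⁻¹))).toNNReal

/-- For `Y = L^p_m`, the weight `x ↦ max {1, |||L_{x⁻¹} | W(L^∞,Y)|||}`. It is only used when the
translations are bounded, so that the maximum is finite. -/
def leftWeight (μ : Measure G) (Q : Set G) (m : G → ℝ≥0) (p : ℝ≥0∞) (x : G) : ℝ≥0 :=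
  (max 1 (opNorm μ Q m p (leftTrans x⁻¹))).toNNReal

end Amalgam

section Representation

variable {G : Type*} [Group G] [TopologicalSpace G]
variable {H : Type*} [NormedAddCommGroup H] [InnerProductSpace ℂ H]

/-- `π` is a (strongly continuous) irreducible unitary representation of `G` on `H`. -/
structure IsIrreducibleUnitaryRep (π : G →* (H ≃ₗᵢ[ℂ] H)) : Prop where
  strongly_continuous : ∀ f : H, Continuous fun x => π x f
  nontrivial : Nontrivial H
  irreducible : ∀ S : Submodule ℂ H, IsClosed (S : Set H) → (∀ x, ∀ f ∈ S, π x f ∈ S) →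
    S = ⊥ ∨ S = ⊤

/-- The voice transform `V_g f (x) = ⟨f, π(x) g⟩`, linear in `f`. -/
def voice (π : G →* (H ≃ₗᵢ[ℂ] H)) (g f : H) (x : G) : ℂ := inner ℂ (π x g) f

variable [MeasurableSpace G]

/-- The admissible vectors `g`, i.e. `V_g g ∈ L²`: the domain of the Duflo-Moore operator. -/
def admissible (μ : Measure G) (π : G →* (H ≃ₗᵢ[ℂ] H)) : Set H :=
  {g | MemLp (voice π g g) 2 μ}

/-- The analyzing vectors `𝔸_v = {g | V_g g ∈ L¹_v}`. -/
def classA (μ : Measure G) (π : G →* (H ≃ₗᵢ[ℂ] H)) (v : G → ℝ≥0) : Set H :=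
  {g | MemWLp μ v 1 (voice π g g)}

/-- The class `𝔹^p_w = {g admissible | V_g g ∈ W(L^∞, L^p_w)}`. -/
def classB (μ : Measure G) (π : G →* (H ≃ₗᵢ[ℂ] H)) (Q : Set G) (w : G → ℝ≥0) (p : ℝ≥0∞) :
    Set H :=
  {g | g ∈ admissible μ π ∧ MemAmalgam μ Q w p (voice π g g)}

/-- The space `H¹_v = {f ∈ H | V_{g₀} f ∈ L¹_v}`, for a fixed `g₀`. -/
def H1 (μ : Measure G) (π : G →* (H ≃ₗᵢ[ℂ] H)) (v : G → ℝ≥0) (g₀ : H) : Submodule ℂ H where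
  carrier := {f | MemWLp μ v 1 (voice π g₀ f)}
  zero_mem' := by
    simp [MemWLp, voice]
  add_mem' := by
    intro a b ha hb
    have h := MemLp.add ha hb
    refine (memLp_congr_ae (Filter.Eventually.of_forall fun x => ?_)).1 h
    simp [voice]
  smul_mem' := by
    intro c a ha
    have h := MemLp.const_smul ha c
    refine (memLp_congr_ae (Filter.Eventually.of_forall fun x => ?_)).1 h
    simp [voice, NNReal.smul_def]
    ring

/-- The anti-dual of `H¹_v`: the conjugate-linear functionals on `H¹_v` that are bounded with
respect to the norm `‖h‖ = ‖V_{g₀} h | L¹_v‖`. -/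
def antidual (μ : Measure G) (π : G →* (H ≃ₗᵢ[ℂ] H)) (v : G → ℝ≥0) (g₀ : H) :
    Set (H1 μ π v g₀ →ₛₗ[starRingEnd ℂ] ℂ) :=
  {f | ∃ C : ℝ≥0, ∀ h : H1 μ π v g₀, ‖f h‖ₑ ≤ C * wLpNorm μ v 1 (voice π g₀ (h : H))}

/-- A vector `u ∈ H`, regarded as the conjugate-linear functional `h ↦ ⟨u, h⟩` on `H¹_v`. -/
def embed (μ : Measure G) (π : G →* (H ≃ₗᵢ[ℂ] H)) (v : G → ℝ≥0) (g₀ : H) (u : H) :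
    H1 μ π v g₀ →ₛₗ[starRingEnd ℂ] ℂ where
  toFun h := inner ℂ (h : H) u
  map_add' a b := by simp
  map_smul' c a := by simp [mul_comm]

variable [IsTopologicalGroup G] [LocallyCompactSpace G]

/-- The class `𝔹(Y) = 𝔹^p_{w_Y} ∩ 𝔸_{v_Y}` for `Y = L^p_m`. -/
def classBY (μ : Measure G) (π : G →* (H ≃ₗᵢ[ℂ] H)) (Q : Set G) (m : G → ℝ≥0) (p : ℝ≥0∞) :
    Set H :=
  classB μ π Q (rightWeight μ Q m p) p ∩ classA μ π (leftWeight μ Q m p)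

/-- The coorbit space `C(Y) = {f ∈ (H¹_v)^¬ | V_g f ∈ W(L^∞, Y)}` for `Y = L^p_m` and
`v = v_Y`, where `g₀` is the vector that defines `H¹_v`, `g` is the analyzing vector, and
`V_g f (x) = ⟨f, π(x) g⟩` is the extended voice transform. -/
def coorbit (μ : Measure G) (π : G →* (H ≃ₗᵢ[ℂ] H)) (Q : Set G) (m : G → ℝ≥0) (p : ℝ≥0∞)
    (g₀ g : H) : Set (H1 μ π (leftWeight μ Q m p) g₀ →ₛₗ[starRingEnd ℂ] ℂ) :=
  {f | f ∈ antidual μ π (leftWeight μ Q m p) g₀ ∧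
    ∃ hg : ∀ x : G, π x g ∈ H1 μ π (leftWeight μ Q m p) g₀,
      MemAmalgam μ Q m p (fun x => f ⟨π x g, hg x⟩)}

end Representation

end CoorbitTheory

end

/-! Write m for `bullet w`. An IN group is unimodular, so right translations and inversion preserve
`μ`. A conjugation-invariant compact neighbourhood V lets windows be moved from one side to the
other: yVx = yxV. Together with finite covers and the inequality (a + b)^p ≤ a^p + b^p for p ≤ 1,
this bounds `R_x` by a multiple of m(x⁻¹), while `L_x` is bounded by m(x). Testing on the indicator
of V gives matching lower bounds, so both weights attached to Y are equivalent to m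
(`exists_weight_equiv`). Sampling along a maximal separated set reduces amalgam norms to ℓ^p sums,
and ℓ^p ⊂ ℓ¹ gives W(L^∞, L^p_m) ⊂ L¹_m for continuous functions (`lintegral_mul_enorm_lt_top`).
Hence 𝔹(Y) = 𝔹^p_m.

The first identity holds because |V_g g| is invariant under inversion and inversion is compatible
with windows (`exists_lintegral_inv_le`).

For the second, the orthogonality relations (`exists_orthogonality`) express V_g h as a multiple of
V_b h * V_g a whenever a and b are not orthogonal, and amalgams are stable under such convolutions
(`ampInt_lt_top_of_le_convolution`). This takes V_u u to V_g u after replacing g by a suitable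
translate. Conversely, if V_g f lies in the amalgam, it is integrable against m, and the reproducing
formula in H¹_m shows that f is represented by a multiple of the vector ∫ V_g f(y) π(y)g dy
(`exists_forall_functional_eq_inner`). Inversion and convolution then lead from V_g u back to V_u u.

Two measure-theoretic points need care. The operator-norm weights are shown to be measurable through
lower semicontinuity, and since G need not be σ-compact, sums and Bochner integrals are reduced to
countable or σ-compact supports. -/

namespace CoorbitTheory

open Set Filter

set_option linter.unusedSectionVars false

/-! ### IN groups are unimodular -/

section Unimodular

variable {G : Type*} [Group G] [TopologicalSpace G] [IsTopologicalGroup G]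
  [LocallyCompactSpace G] [MeasurableSpace G] [BorelSpace G]

/-- A set with xV = Vx has right translates that are left translates, hence of equal measure; as
this measure is positive and finite, the scaling factor is 1. -/
theorem modularCharacterFun_eq_one [T2Space G] (μ : Measure G) [μ.IsHaarMeasure] [μ.Regular]
    (hIN : IsINGroup G) (x : G) : Measure.modularCharacterFun x = 1 := by
  obtain ⟨V, hVc, hV1, hV⟩ := hIN
  have key : Measure.map (· * x) μ = Measure.modularCharacterFun x • μ := by
    have : (Measure.map (· * x) μ).Regular := Measure.Regular.map (Homeomorph.mulRight x)
    rw [Measure.modularCharacterFun_eq_haarScalarFactor μ]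
    exact Measure.isMulLeftInvariant_eq_smul_of_regular _ μ
  have hmV : MeasurableSet V := hVc.isClosed.measurableSet
  have h1 : (· * x) ⁻¹' V = (fun y => x * y) ⁻¹' V := by
    have := hV x⁻¹
    rw [← Set.image_mul_left', ← Set.image_mul_right', this]
  have h2 : Measure.map (· * x) μ V = μ V := by
    rw [Measure.map_apply (measurable_mul_const x) hmV, h1, measure_preimage_mul]
  rw [key] at h2
  have hpos : μ V ≠ 0 := (Measure.measure_pos_of_mem_nhds μ hV1).ne'
  have h3 : (Measure.modularCharacterFun x : ℝ≥0∞) * μ V = 1 * μ V := by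
    rw [one_mul]; exact h2
  have := (ENNReal.mul_left_inj hpos hVc.measure_lt_top.ne).1 h3
  exact_mod_cast this

theorem modulus_eq_one [T2Space G] (μ : Measure G) [μ.IsHaarMeasure] [μ.Regular]
    (hIN : IsINGroup G) (x : G) : modulus x = 1 :=
  modularCharacterFun_eq_one μ hIN x⁻¹

theorem isMulRightInvariant_of_isINGroup [T2Space G] (μ : Measure G) [μ.IsHaarMeasure] [μ.Regular]
    (hIN : IsINGroup G) : μ.IsMulRightInvariant := by
  refine ⟨fun x => ?_⟩
  have key : Measure.map (· * x) μ = Measure.modularCharacterFun x • μ := by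
    have : (Measure.map (· * x) μ).Regular := Measure.Regular.map (Homeomorph.mulRight x)
    rw [Measure.modularCharacterFun_eq_haarScalarFactor μ]
    exact Measure.isMulLeftInvariant_eq_smul_of_regular _ μ
  rw [key, modularCharacterFun_eq_one μ hIN, one_smul]

/-- The inverted measure is again left invariant, hence equals c • `μ`; inverting twice gives c² =
1. -/
theorem isInvInvariant_of_isMulRightInvariant [T2Space G] (μ : Measure G) [μ.IsHaarMeasure]
    [μ.Regular] [μ.IsMulRightInvariant] : μ.IsInvInvariant := by
  constructor
  let c : ℝ≥0∞ := Measure.haarScalarFactor μ.inv μ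
  have hc : μ.inv = c • μ := Measure.isMulLeftInvariant_eq_smul_of_regular μ.inv μ
  have : Measure.map Inv.inv (Measure.map Inv.inv μ) = c ^ 2 • μ := by
    rw [← Measure.inv_def μ, hc, Measure.map_smul, ← Measure.inv_def μ, hc, smul_smul, pow_two]
  have μeq : μ = c ^ 2 • μ := by
    rw [Measure.map_map continuous_inv.measurable continuous_inv.measurable] at this
    simpa only [inv_involutive, Function.Involutive.comp_self, Measure.map_id]
  have K : TopologicalSpace.PositiveCompacts G := Classical.arbitrary _
  have : c ^ 2 * μ K = 1 ^ 2 * μ K := by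
    conv_rhs => rw [μeq]
    simp
  have : c ^ 2 = 1 ^ 2 :=
    (ENNReal.mul_left_inj (Measure.measure_pos_of_nonempty_interior _ K.interior_nonempty).ne'
      K.isCompact.measure_lt_top.ne).1 this
  have : c = 1 := (ENNReal.pow_right_strictMono two_ne_zero).injective this
  rw [hc, this, one_smul]

end Unimodular

/-! ### Submultiplicative weights and symmetrization -/

section Weights

variable {G : Type*} [Group G] {w : G → ℝ≥0}

theorem bullet_inv (x : G) : bullet w x⁻¹ = bullet w x := by
  simp [bullet, max_comm]

variable [TopologicalSpace G]

/-- Since 1 ≤ w(1) ≤ w(x) w(x⁻¹), the two factors cannot both be less than 1. -/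
theorem IsSubmulWeight.one_le_bullet (hw : IsSubmulWeight w) (x : G) : 1 ≤ bullet w x := by
  have h1 : 1 ≤ w 1 := by
    have := hw.submul 1 1
    rw [mul_one] at this
    exact le_of_mul_le_mul_left (by simpa using this) (hw.pos 1)
  by_contra! h
  rw [bullet, max_lt_iff] at h
  have := hw.submul x x⁻¹
  rw [mul_inv_cancel] at this
  exact absurd (h1.trans this) (not_le.2 (mul_lt_one_of_nonneg_of_lt_one_left zero_le h.1 h.2.le))

theorem IsSubmulWeight.bullet [IsTopologicalGroup G] (hw : IsSubmulWeight w) :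
    IsSubmulWeight (bullet w) where
  pos x := lt_max_of_lt_left (hw.pos x)
  continuous := hw.continuous.max (hw.continuous.comp continuous_inv)
  submul x y := by
    refine max_le ((hw.submul x y).trans ?_) ?_
    · gcongr <;> exact le_max_left _ _
    · rw [mul_inv_rev, mul_comm (CoorbitTheory.bullet w x)]
      refine (hw.submul _ _).trans ?_
      gcongr <;> exact le_max_right _ _

end Weights

/-! ### Lower semicontinuity of products and parameter integrals -/

section LSC

theorem lowerSemicontinuous_coe_mul {X : Type*} [TopologicalSpace X] {m : X → ℝ≥0}
    (hm : Continuous m) (hpos : ∀ x, 0 < m x) {e : X → ℝ≥0∞} (he : LowerSemicontinuous e) :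
    LowerSemicontinuous fun x => (m x : ℝ≥0∞) * e x := by
  intro x c hc
  have key : ∀ y, c < m y * e y ↔ c / m y < e y := fun y => by
    rw [ENNReal.div_lt_iff (.inl (by simpa using (hpos y).ne')) (.inl (by simp)), mul_comm]
  obtain ⟨q, hq1, hq2⟩ := exists_between ((key x).1 hc)
  have hcont : ContinuousAt (fun y => c / (m y : ℝ≥0∞)) x := by
    have h1 : ContinuousAt (fun y => (m y : ℝ≥0∞)⁻¹) x :=
      (continuous_inv.comp (ENNReal.continuous_coe.comp hm)).continuousAt
    refine ENNReal.Tendsto.const_mul h1 (.inl ?_)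
    simp
  filter_upwards [hcont.eventually_lt_const hq1, he x q hq2] with y h1 h2
  exact (key y).2 (h1.trans h2)

theorem lowerSemicontinuous_rpow {X : Type*} [TopologicalSpace X] {r : ℝ} (hr : 0 ≤ r)
    {e : X → ℝ≥0∞} (he : LowerSemicontinuous e) : LowerSemicontinuous fun x => e x ^ r :=
  (ENNReal.continuous_rpow_const (y := r)).comp_lowerSemicontinuous he
    (ENNReal.monotone_rpow_of_nonneg hr)

/-- The integral of a jointly lower semicontinuous function depends lower semicontinuously on the
parameter. -/
theorem lowerSemicontinuous_lintegral_of_prod {X Y : Type*} [TopologicalSpace X]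
    [TopologicalSpace Y] [T2Space Y] [MeasurableSpace Y] [BorelSpace Y] (μ : Measure Y)
    [μ.InnerRegularCompactLTTop] {Φ : X × Y → ℝ≥0∞} (hΦ : LowerSemicontinuous Φ)
    (hfin : ∀ x, ∫⁻ y, Φ (x, y) ∂μ ≠ ∞) : LowerSemicontinuous fun x => ∫⁻ y, Φ (x, y) ∂μ := by
  intro x c hc
  change c < ∫⁻ y, Φ (x, y) ∂μ at hc
  rw [lintegral_eq_nnreal] at hc
  obtain ⟨s, hs⟩ := lt_iSup_iff.1 hc
  obtain ⟨hsΦ, hs⟩ := lt_iSup_iff.1 hs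
  -- shrink the values and the level sets
  have hsfin : ∀ t ∈ s.range, t ≠ 0 → μ (s ⁻¹' {t}) ≠ ∞ := by
    intro t _ ht htop
    have h1 : (t : ℝ≥0∞) * μ (s ⁻¹' {t}) ≤ ∫⁻ y, Φ (x, y) ∂μ := by
      rw [← setLIntegral_const]
      refine (setLIntegral_mono' (s.measurableSet_fiber t) fun y hy => ?_).trans
        (setLIntegral_le_lintegral _ _)
      have := hsΦ y
      rw [show s y = t from hy] at this
      exact this
    rw [htop, ENNReal.mul_top (by simpa using ht)] at h1
    exact hfin x (top_le_iff.1 h1)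
  have hsum : (s.map ((↑) : ℝ≥0 → ℝ≥0∞)).lintegral μ =
      ∑ t ∈ s.range, (t : ℝ≥0∞) * μ (s ⁻¹' {t}) := by
    rw [SimpleFunc.map_lintegral]
  rw [hsum] at hs
  have hnear : ∃ K : ℝ≥0 → Set Y, ∃ a : ℝ≥0 → ℝ≥0, (∀ t ∈ s.range, IsCompact (K t) ∧
      K t ⊆ s ⁻¹' {t} ∧ (t ≠ 0 → a t < t) ∧ (t = 0 → a t = 0)) ∧
      c < ∑ t ∈ s.range, (a t : ℝ≥0∞) * μ (K t) := by
    -- each summand can be approximated from below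
    have hlt : ∀ t ∈ s.range, ∀ b < (t : ℝ≥0∞) * μ (s ⁻¹' {t}), ∃ K : Set Y, ∃ a : ℝ≥0,
        IsCompact K ∧ K ⊆ s ⁻¹' {t} ∧ (t ≠ 0 → a < t) ∧ (t = 0 → a = 0) ∧
          b < (a : ℝ≥0∞) * μ K := by
      intro t ht b hb
      have ht0 : t ≠ 0 := by rintro rfl; simp at hb
      have hbt : b / t < μ (s ⁻¹' {t}) := by
        rw [ENNReal.div_lt_iff (.inl (by simpa using ht0)) (.inl (by simp)), mul_comm]
        exact hb
      obtain ⟨K, hK, hKc, hKb⟩ := (s.measurableSet_fiber t).exists_lt_isCompact_of_ne_top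
        (hsfin t ht ht0) hbt
      have hK0 : μ K ≠ 0 := (zero_le.trans_lt hKb).ne'
      have hKt : μ K ≠ ∞ := ((measure_mono hK).trans_lt (hsfin t ht ht0).lt_top).ne
      have hlt : b / μ K < t := by
        rw [ENNReal.div_lt_iff (.inl hK0) (.inl hKt)]
        rwa [ENNReal.div_lt_iff (.inl (by simpa using ht0)) (.inl (by simp)), mul_comm] at hKb
      obtain ⟨a, ha1, ha2⟩ := ENNReal.lt_iff_exists_nnreal_btwn.1 hlt
      refine ⟨K, a, hKc, hK, fun _ => by exact_mod_cast ha2, fun h => absurd h ht0, ?_⟩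
      rwa [ENNReal.div_lt_iff (.inl hK0) (.inl hKt)] at ha1
    -- pass to the sum
    have hne : ∃ b : ℝ≥0 → ℝ≥0∞, (∀ t ∈ s.range, b t < (t : ℝ≥0∞) * μ (s ⁻¹' {t}) ∨
        (t : ℝ≥0∞) * μ (s ⁻¹' {t}) = 0 ∧ b t = 0) ∧ c < ∑ t ∈ s.range, b t := by
      by_contra! hcon
      -- If no such b existed, taking b as q times each summand would bound q times the sum by c for
      -- every q < 1; letting q tend to 1 contradicts `hs`.
      have htend : Tendsto (fun q : ℝ≥0 => ∑ t ∈ s.range, (q : ℝ≥0∞) *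
          ((t : ℝ≥0∞) * μ (s ⁻¹' {t}))) (𝓝[<] 1)
          (𝓝 (∑ t ∈ s.range, ((1 : ℝ≥0) : ℝ≥0∞) * ((t : ℝ≥0∞) * μ (s ⁻¹' {t})))) := by
        refine tendsto_finsetSum _ fun t ht => ?_
        refine ENNReal.Tendsto.mul_const ?_ (.inl (by simp))
        exact (ENNReal.continuous_coe.tendsto 1).mono_left nhdsWithin_le_nhds
      have : (𝓝[<] (1 : ℝ≥0)).NeBot := nhdsLT_neBot_of_exists_lt ⟨0, zero_lt_one⟩
      have hle : (∑ t ∈ s.range, ((1 : ℝ≥0) : ℝ≥0∞) * ((t : ℝ≥0∞) * μ (s ⁻¹' {t}))) ≤ c := by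
        refine le_of_tendsto htend ?_
        filter_upwards [self_mem_nhdsWithin] with q hq
        refine hcon _ fun t ht => ?_
        have hq : (q : ℝ≥0∞) < 1 := by exact_mod_cast hq
        by_cases h0 : (t : ℝ≥0∞) * μ (s ⁻¹' {t}) = 0
        · exact .inr ⟨h0, by rw [h0, mul_zero]⟩
        · left
          have hft : (t : ℝ≥0∞) * μ (s ⁻¹' {t}) ≠ ∞ := by
            have ht0 : t ≠ 0 := by rintro rfl; simp at h0
            exact ENNReal.mul_ne_top (by simp) (hsfin t ht ht0)
          calc _ < 1 * ((t : ℝ≥0∞) * μ (s ⁻¹' {t})) :=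
                (ENNReal.mul_lt_mul_iff_left h0 hft).2 hq
            _ = _ := one_mul _
      simp only [ENNReal.coe_one, one_mul] at hle
      exact absurd hs (not_lt.2 hle)
    obtain ⟨b, hb, hcb⟩ := hne
    have : ∀ t : ℝ≥0, ∃ K : Set Y, ∃ a : ℝ≥0, t ∈ s.range → (IsCompact K ∧ K ⊆ s ⁻¹' {t} ∧
        (t ≠ 0 → a < t) ∧ (t = 0 → a = 0) ∧ b t ≤ (a : ℝ≥0∞) * μ K) := by
      intro t
      by_cases ht : t ∈ s.range
      · rcases hb t ht with h | h
        · obtain ⟨K, a, h1, h2, h3, h4, h5⟩ := hlt t ht _ h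
          exact ⟨K, a, fun _ => ⟨h1, h2, h3, h4, h5.le⟩⟩
        · exact ⟨∅, 0, fun _ => ⟨isCompact_empty, empty_subset _, fun h0 => pos_iff_ne_zero.2 h0,
            fun _ => rfl, by simp [h.2]⟩⟩
      · exact ⟨∅, 0, fun h => absurd h ht⟩
    choose K a hKa using this
    refine ⟨K, a, fun t ht => ⟨(hKa t ht).1, (hKa t ht).2.1, (hKa t ht).2.2.1,
      (hKa t ht).2.2.2.1⟩, hcb.trans_le (Finset.sum_le_sum fun t ht => (hKa t ht).2.2.2.2)⟩
  obtain ⟨K, a, hKa, hcK⟩ := hnear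
  -- For t ≠ 0 the strict inequality a t < Φ(x, y) is stable near (x, y), and compactness of K t
  -- yields one neighbourhood of x that serves all y in K t.
  have hev : ∀ᶠ z in 𝓝 x, ∀ t ∈ s.range, ∀ y ∈ K t, (a t : ℝ≥0∞) ≤ Φ (z, y) := by
    rw [Finset.eventually_all]
    intro t ht
    refine (hKa t ht).1.eventually_forall_of_forall_eventually fun y hy => ?_
    by_cases ht0 : t = 0
    · simp [(hKa t ht).2.2.2 ht0]
    have hlt : (a t : ℝ≥0∞) < Φ (x, y) := by
      refine lt_of_lt_of_le ?_ (hsΦ y)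
      rw [show s y = t from (hKa t ht).2.1 hy]
      exact_mod_cast (hKa t ht).2.2.1 ht0
    exact (hΦ (x, y) _ hlt).mono fun z hz => hz.le
  filter_upwards [hev] with z hz
  have hmK : ∀ t ∈ s.range, MeasurableSet (K t) := fun t ht => (hKa t ht).1.isClosed.measurableSet
  have hdisj : (s.range : Set ℝ≥0).PairwiseDisjoint K := by
    intro t ht u hu htu
    refine Disjoint.mono (hKa t ht).2.1 (hKa u hu).2.1 ?_
    rw [Set.disjoint_left]
    rintro y rfl h
    exact htu h
  calc c < ∑ t ∈ s.range, (a t : ℝ≥0∞) * μ (K t) := hcK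
    _ ≤ ∑ t ∈ s.range, ∫⁻ y in K t, Φ (z, y) ∂μ := by
        refine Finset.sum_le_sum fun t ht => ?_
        rw [← setLIntegral_const]
        exact setLIntegral_mono' (hmK t ht) fun y hy => hz t ht y hy
    _ = ∫⁻ y in ⋃ t ∈ s.range, K t, Φ (z, y) ∂μ :=
        (lintegral_biUnion_finset hdisj hmK _).symm
    _ ≤ ∫⁻ y, Φ (z, y) ∂μ := setLIntegral_le_lintegral _ _

end LSC

/-! ### Essential suprema over sets -/

section LocalSup

variable {G : Type*} [MeasurableSpace G]

/-- The essential supremum of `‖F‖` over a set. -/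
noncomputable def localSup (μ : Measure G) (F : G → ℂ) (E : Set G) : ℝ≥0∞ :=
  eLpNorm F ∞ (μ.restrict E)

variable {μ : Measure G} {F : G → ℂ}

theorem localSup_le_iff {E : Set G} {c : ℝ≥0∞} :
    localSup μ F E ≤ c ↔ ∀ᵐ y ∂μ.restrict E, ‖F y‖ₑ ≤ c := by
  rw [localSup, eLpNorm_exponent_top]
  exact ⟨fun h => ae_le_eLpNormEssSup.mono fun y hy => hy.trans h,
    eLpNormEssSup_le_of_ae_enorm_bound⟩

theorem localSup_mono {E E' : Set G} (h : E ⊆ E') : localSup μ F E ≤ localSup μ F E' :=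
  eLpNorm_mono_measure _ (Measure.restrict_mono_set μ h)

theorem localSup_le_sum {ι : Type*} (s : Finset ι) {E : Set G} {E' : ι → Set G}
    (h : E ⊆ ⋃ i ∈ s, E' i) : localSup μ F E ≤ ∑ i ∈ s, localSup μ F (E' i) := by
  refine (localSup_mono h).trans (localSup_le_iff.2 ?_)
  rw [ae_restrict_biUnion_finset_iff]
  exact fun i hi => localSup_le_iff.1
    (Finset.single_le_sum (f := fun i => localSup μ F (E' i)) (fun _ _ => zero_le) hi)

theorem localSup_comp_measurableEquiv {e : G ≃ᵐ G} (he : MeasurePreserving e μ μ) (E : Set G) :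
    localSup μ (F ∘ e) E = localSup μ F (e '' E) := by
  rw [localSup, localSup, ← e.measurableEmbedding.eLpNorm_map_measure,
    (he.restrict_image_emb e.measurableEmbedding E).map_eq]

theorem localSup_congr_norm {F' : G → ℂ} (h : ∀ x, ‖F x‖ = ‖F' x‖) (E : Set G) :
    localSup μ F E = localSup μ F' E :=
  eLpNorm_congr_norm_ae (.of_forall h)

/-- A neighbourhood of y has positive measure, so an almost everywhere bound on E cannot ignore it.
-/
theorem le_localSup_of_eventually [TopologicalSpace G] [OpensMeasurableSpace G]
    [μ.IsOpenPosMeasure] {c : ℝ≥0∞} {E : Set G} {y : G} (hF : ∀ᶠ z in 𝓝 y, c ≤ ‖F z‖ₑ)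
    (hy : E ∈ 𝓝 y) : c ≤ localSup μ F E := by
  by_contra! hlt
  have h1 := Measure.measure_pos_of_mem_nhds μ (inter_mem hF (interior_mem_nhds.2 hy))
  have h4 : ∀ᵐ z ∂μ.restrict (interior E), ‖F z‖ₑ ≤ localSup μ F E :=
    ae_restrict_of_ae_restrict_of_subset interior_subset (localSup_le_iff.1 le_rfl)
  rw [ae_restrict_iff' isOpen_interior.measurableSet, ae_iff] at h4
  refine h1.ne' (measure_mono_null (fun z hz => ?_) h4)
  simp only [mem_ofPred_eq, Classical.not_imp, not_le]
  exact ⟨hz.2, hlt.trans_le hz.1⟩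

theorem enorm_le_localSup [TopologicalSpace G] [OpensMeasurableSpace G] [μ.IsOpenPosMeasure]
    (hF : Continuous F) {E : Set G} {y : G} (hy : E ∈ 𝓝 y) : ‖F y‖ₑ ≤ localSup μ F E :=
  le_of_forall_lt_imp_le_of_dense fun _ hc => le_localSup_of_eventually
    ((hF.enorm.continuousAt.eventually_const_lt hc).mono fun _ h => h.le) hy

theorem localSup_le_of_forall {E : Set G} (hE : MeasurableSet E) {c : ℝ≥0∞}
    (h : ∀ y ∈ E, ‖F y‖ₑ ≤ c) : localSup μ F E ≤ c :=
  localSup_le_iff.2 (ae_restrict_of_forall_mem hE h)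

end LocalSup

/-! ### Amalgam integrals: windows and translations -/

section Group

variable {G : Type*} [Group G] [TopologicalSpace G] [IsTopologicalGroup G]
  [LocallyCompactSpace G] [T2Space G] [MeasurableSpace G] [BorelSpace G]
  {μ : Measure G} [μ.IsHaarMeasure] [μ.Regular]

theorem isCompact_closure_two_sided {E : Set G} (hE : IsCompact (closure E)) (a b : G) :
    ∃ C, IsCompact C ∧ IsClosed C ∧ (fun q => a * q * b) '' E ⊆ C :=
  ⟨(fun q => a * q * b) '' closure E, hE.image (by fun_prop),
    ((Homeomorph.mulLeft a).trans (Homeomorph.mulRight b)).isClosedMap _ isClosed_closure,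
    image_mono subset_closure⟩

/-- The local suprema over the two-sided translates of a relatively compact set depend lower
semicontinuously on the translations. -/
theorem lowerSemicontinuous_localSup [μ.IsMulRightInvariant] {F : G → ℂ}
    (hF : ∀ C : Set G, IsCompact C → AEStronglyMeasurable F (μ.restrict C))
    {E : Set G} (hE : MeasurableSet E) (hEc : IsCompact (closure E)) :
    LowerSemicontinuous fun z : G × G => localSup μ F ((fun q => z.1 * q * z.2) '' E) := by
  rintro ⟨a, b⟩ c hc
  change c < localSup μ F ((fun q => a * q * b) '' E) at hc
  set e : G → G → (G ≃ₜ G) := fun a b => (Homeomorph.mulLeft a).trans (Homeomorph.mulRight b)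
  have hmeas : ∀ a b : G, ∀ S : Set G, MeasurableSet S →
      MeasurableSet ((fun q => a * q * b) '' S) := fun a b S hS =>
    (e a b).toMeasurableEquiv.measurableSet_image.2 hS
  have hvol : ∀ a b : G, ∀ S : Set G, μ ((fun q => a * q * b) '' S) = μ S := by
    intro a b S
    have : (fun q => a * q * b) '' S = (fun q => q * b⁻¹) ⁻¹' ((fun q => a⁻¹ * q) ⁻¹' S) := by
      rw [← Set.image_mul_left, ← Set.image_mul_right, Set.image_image]
    rw [this, measure_preimage_mul_right, measure_preimage_mul]
  set A := (fun q => a * q * b) '' E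
  have hAm : MeasurableSet A := hmeas a b E hE
  obtain ⟨C, hC, hCcl, hAC⟩ := isCompact_closure_two_sided hEc a b
  have hnull : NullMeasurableSet {y | c < ‖F y‖ₑ} (μ.restrict A) :=
    nullMeasurableSet_lt aemeasurable_const
      ((hF C hC).mono_measure (Measure.restrict_mono_set μ hAC)).enorm
  have hpos : μ.restrict A {y | c < ‖F y‖ₑ} ≠ 0 := by
    intro h0
    refine absurd hc (not_lt.2 (localSup_le_iff.2 ?_))
    rw [ae_iff]
    simpa using h0
  obtain ⟨B, hBsub, hBm, hBae⟩ := hnull.exists_measurable_subset_ae_eq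
  rw [← measure_congr hBae, Measure.restrict_apply hBm] at hpos
  have hfin : μ (B ∩ A) ≠ ∞ :=
    ((measure_mono (inter_subset_right.trans hAC)).trans_lt hC.measure_lt_top).ne
  obtain ⟨K, hKsub, hK, hK0⟩ := (hBm.inter hAm).exists_lt_isCompact_of_ne_top hfin
    (pos_iff_ne_zero.2 hpos)
  have hKfin : μ K ≠ ∞ := hK.measure_lt_top.ne
  -- U has less than twice the measure of K, so a translate of K that stays in U must overlap K in
  -- positive measure, and on K one has |F| > c.
  obtain ⟨U, hKU, hU, hμU⟩ := hK.exists_isOpen_lt_of_lt (μ := μ) (μ K + μ K)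
    (ENNReal.lt_add_right hKfin hK0.ne')
  have hev : ∀ᶠ z : G × G in 𝓝 (a, b), ∀ y ∈ K, (z.1 * a⁻¹) * y * (b⁻¹ * z.2) ∈ U := by
    refine hK.eventually_forall_of_forall_eventually fun y hy => ?_
    have hcont : Continuous fun z : (G × G) × G => (z.1.1 * a⁻¹) * z.2 * (b⁻¹ * z.1.2) := by
      fun_prop
    refine hcont.continuousAt.eventually_mem (hU.mem_nhds ?_)
    simpa using hKU hy
  filter_upwards [hev] with z hz
  by_contra! hle
  rw [localSup_le_iff, ae_restrict_iff' (hmeas _ _ _ hE), ae_iff] at hle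
  set K' := (fun q => z.1 * a⁻¹ * q * (b⁻¹ * z.2)) '' K
  have hK' : K' ⊆ (fun q => z.1 * q * z.2) '' E := by
    rintro _ ⟨k, hk, rfl⟩
    obtain ⟨q, hq, rfl⟩ := (hKsub hk).2
    exact ⟨q, hq, by simp [mul_assoc]⟩
  have hKK' : μ (K ∩ K') = 0 := by
    refine measure_mono_null (fun y hy => ?_) hle
    have h1 : c < ‖F y‖ₑ := hBsub (hKsub hy.1).1
    simp only [mem_ofPred_eq, Classical.not_imp, not_le]
    exact ⟨hK' hy.2, h1⟩
  have h2 : μ (K ∪ K') = μ K + μ K := by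
    have := measure_union_add_inter (μ := μ) K (hmeas (z.1 * a⁻¹) (b⁻¹ * z.2) K hK.measurableSet)
    rw [hKK', add_zero, hvol] at this
    exact this
  have h3 : μ (K ∪ K') ≤ μ U :=
    measure_mono (union_subset hKU (by rintro _ ⟨k, hk, rfl⟩; exact hz k hk))
  exact absurd hμU (not_lt.2 (h2 ▸ h3))

theorem lowerSemicontinuous_localSup_left [μ.IsMulRightInvariant] {F : G → ℂ}
    (hF : ∀ C : Set G, IsCompact C → AEStronglyMeasurable F (μ.restrict C))
    {E : Set G} (hE : MeasurableSet E) (hEc : IsCompact (closure E)) :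
    LowerSemicontinuous fun x : G => localSup μ F (x • E) := by
  have h := (lowerSemicontinuous_localSup (μ := μ) hF hE hEc).comp
    (g := fun x : G => (x, (1 : G))) (by fun_prop)
  refine fun x c hc => ?_
  simpa [Function.comp_def, ← image_smul] using h x c (by simpa [Function.comp_def, ← image_smul] using hc)

/-- The `r`-th power of the `L^r_m` quasi-norm of the control function with window `E`. -/
noncomputable def ampInt (μ : Measure G) (m : G → ℝ≥0) (r : ℝ) (F : G → ℂ) (E : Set G) : ℝ≥0∞ :=
  ∫⁻ y, (m y * localSup μ F (y • E)) ^ r ∂μ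

variable {m : G → ℝ≥0} {r : ℝ} {F : G → ℂ}

theorem measurable_ampInt_integrand [μ.IsMulRightInvariant] (hm : Measurable m)
    (hF : ∀ C : Set G, IsCompact C → AEStronglyMeasurable F (μ.restrict C))
    {E : Set G} (hE : MeasurableSet E) (hEc : IsCompact (closure E)) :
    Measurable fun y => ((m y : ℝ≥0∞) * localSup μ F (y • E)) ^ r :=
  ((measurable_coe_nnreal_ennreal.comp hm).mul
    (lowerSemicontinuous_localSup_left hF hE hEc).measurable).pow_const r

/-- The substitution y ↦ y a⁻¹, which needs right invariance, moves the translation from the window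
to the weight. -/
theorem ampInt_smul_le [μ.IsMulRightInvariant] (hm : IsSubmulWeight m) (hr : 0 < r) (a : G)
    (E : Set G) : ampInt μ m r F (a • E) ≤ (m a⁻¹ : ℝ≥0∞) ^ r * ampInt μ m r F E := by
  have h1 : ampInt μ m r F (a • E) =
      ∫⁻ y, ((m (y * a⁻¹) : ℝ≥0∞) * localSup μ F (y • E)) ^ r ∂μ := by
    rw [ampInt, ← lintegral_mul_right_eq_self _ a⁻¹]
    simp [smul_smul]
  rw [h1, ampInt, ← lintegral_const_mul' _ _ (by simp [hr.le])]
  refine lintegral_mono fun y => ?_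
  rw [← ENNReal.mul_rpow_of_nonneg _ _ hr.le, ← mul_assoc]
  refine ENNReal.rpow_le_rpow ?_ hr.le
  gcongr
  rw [mul_comm]
  exact_mod_cast hm.submul y a⁻¹

/-- This replaces the triangle inequality, which fails for exponents below 1. -/
theorem finset_sum_rpow_le {ι : Type*} (hr : 0 < r) (hr1 : r ≤ 1) (t : Finset ι)
    (f : ι → ℝ≥0∞) : (∑ a ∈ t, f a) ^ r ≤ ∑ a ∈ t, f a ^ r := by
  induction t using Finset.cons_induction with
  | empty => simp [ENNReal.zero_rpow_of_pos hr]
  | cons a t ha ih =>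
    rw [Finset.sum_cons, Finset.sum_cons]
    exact (ENNReal.rpow_add_le_add_rpow _ _ hr.le hr1).trans (by gcongr)

/-- Integrals of local suprema over sets that are covered by finitely many translates of a
relatively compact set. -/
theorem lintegral_localSup_le_sum [μ.IsMulRightInvariant] (hm : IsSubmulWeight m) (hr : 0 < r)
    (hr1 : r ≤ 1) (hF : ∀ C : Set G, IsCompact C → AEStronglyMeasurable F (μ.restrict C))
    {ι : Type*} (s : Finset ι) (a : ι → G) {S : G → Set G}
    {E : Set G} (hE : MeasurableSet E) (hEc : IsCompact (closure E))
    (h : ∀ y, S y ⊆ ⋃ i ∈ s, y • a i • E) :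
    ∫⁻ y, ((m y : ℝ≥0∞) * localSup μ F (S y)) ^ r ∂μ ≤
      (∑ i ∈ s, (m (a i)⁻¹ : ℝ≥0∞) ^ r) * ampInt μ m r F E := by
  calc _ ≤ ∫⁻ y, ∑ i ∈ s, ((m y : ℝ≥0∞) * localSup μ F (y • a i • E)) ^ r ∂μ := by
        refine lintegral_mono fun y => ?_
        refine le_trans ?_ (finset_sum_rpow_le hr hr1 s _)
        rw [← Finset.mul_sum]
        refine ENNReal.rpow_le_rpow ?_ hr.le
        gcongr
        exact localSup_le_sum s (h y)
    _ = ∑ i ∈ s, ampInt μ m r F (a i • E) := by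
        refine lintegral_finsetSum _ fun i _ => measurable_ampInt_integrand hm.continuous.measurable hF
          (hE.const_smul _) ?_
        rw [closure_smul]
        exact hEc.smul (a i)
    _ ≤ _ := by
        rw [Finset.sum_mul]
        exact Finset.sum_le_sum fun i _ => ampInt_smul_le hm hr _ _

theorem exists_finset_cover {E E' : Set G} (hE : IsCompact (closure E)) (hE' : E' ∈ 𝓝 (1 : G)) :
    ∃ s : Finset G, E ⊆ ⋃ a ∈ s, a • E' := by
  obtain ⟨t, -, ht⟩ := hE.elim_nhds_subcover (fun a => a • E') fun a _ => by
    simpa using smul_mem_nhds_smul a hE'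
  exact ⟨t, subset_closure.trans ht⟩

/-- Different windows define the same amalgam spaces. -/
theorem exists_ampInt_le [μ.IsMulRightInvariant] (hm : IsSubmulWeight m) (hr : 0 < r)
    (hr1 : r ≤ 1) {E E' : Set G} (hE : IsCompact (closure E)) (hE' : IsWindow E') :
    ∃ C : ℝ≥0, ∀ F : G → ℂ,
      (∀ C : Set G, IsCompact C → AEStronglyMeasurable F (μ.restrict C)) →
      ampInt μ m r F E ≤ C * ampInt μ m r F E' := by
  obtain ⟨s, hs⟩ := exists_finset_cover hE hE'.mem_nhds
  refine ⟨∑ a ∈ s, (m a⁻¹) ^ r, fun F hF => ?_⟩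
  have := lintegral_localSup_le_sum (μ := μ) hm hr hr1 hF s id (S := fun y => y • E)
    hE'.measurableSet hE'.relCompact fun y => by
      refine (smul_set_mono hs).trans ?_
      simp [smul_set_iUnion]
  refine this.trans (le_of_eq ?_)
  push_cast
  congr 2
  ext i
  simp [ENNReal.coe_rpow_of_nonneg _ hr.le]

theorem localSup_leftTrans (x : G) (E : Set G) :
    localSup μ (leftTrans x F) E = localSup μ F (x⁻¹ • E) :=
  localSup_comp_measurableEquiv (e := MeasurableEquiv.mulLeft x⁻¹)
    (measurePreserving_mul_left μ x⁻¹) E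

theorem localSup_rightTrans [μ.IsMulRightInvariant] (x : G) (E : Set G) :
    localSup μ (rightTrans x F) E = localSup μ F ((fun q => q * x) '' E) :=
  localSup_comp_measurableEquiv (e := MeasurableEquiv.mulRight x)
    (measurePreserving_mul_right μ x) E

theorem ampInt_leftTrans_le (hm : IsSubmulWeight m) (hr : 0 < r) (x : G) (E : Set G) :
    ampInt μ m r (leftTrans x F) E ≤ (m x : ℝ≥0∞) ^ r * ampInt μ m r F E := by
  rw [ampInt, ← lintegral_mul_left_eq_self _ x, ampInt, ← lintegral_const_mul' _ _ (by simp [hr.le])]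
  refine lintegral_mono fun y => ?_
  rw [← ENNReal.mul_rpow_of_nonneg _ _ hr.le, ← mul_assoc, localSup_leftTrans]
  simp only [smul_smul, inv_mul_cancel_left]
  refine ENNReal.rpow_le_rpow ?_ hr.le
  gcongr
  exact_mod_cast hm.submul x y

theorem IsINGroup.exists_window (hIN : IsINGroup G) : ∃ V : Set G, IsCompact V ∧ IsWindow V ∧
    ∀ x : G, x • V = (fun q => q * x) '' V := by
  obtain ⟨V, hVc, hV1, hV⟩ := hIN
  exact ⟨V, hVc, ⟨hVc.isClosed.measurableSet, hV1, hVc.closure⟩, fun x => by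
    rw [← hV x]; rfl⟩

/-- Right translation turns the window yQ into yQx. If Q is covered by the sets aV, then yQx is
covered by yaVx = yaxV; the number of pieces does not depend on x, and the left translates by ax
cost only m(x⁻¹a⁻¹). -/
theorem exists_ampInt_rightTrans_le [μ.IsMulRightInvariant] (hIN : IsINGroup G)
    (hm : IsSubmulWeight m) (hr : 0 < r) (hr1 : r ≤ 1) {Q : Set G} (hQ : IsWindow Q) :
    ∃ C : ℝ≥0, ∀ (x : G) (F : G → ℂ),
      (∀ C : Set G, IsCompact C → AEStronglyMeasurable F (μ.restrict C)) →
      ampInt μ m r (rightTrans x F) Q ≤ C * (m x⁻¹ : ℝ≥0∞) ^ r * ampInt μ m r F Q := by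
  obtain ⟨V, hVc, hV, hVx⟩ := hIN.exists_window
  obtain ⟨s, hs⟩ := exists_finset_cover hQ.relCompact hV.mem_nhds
  obtain ⟨C, hC⟩ := exists_ampInt_le (μ := μ) hm hr hr1 hV.relCompact hQ
  refine ⟨(∑ a ∈ s, (m a⁻¹) ^ r) * C, fun x F hF => ?_⟩
  have := lintegral_localSup_le_sum (μ := μ) hm hr hr1 hF s (fun a => a * x)
    (S := fun y => (fun q => q * x) '' (y • Q)) hV.measurableSet hV.relCompact fun y => by
      rintro _ ⟨_, ⟨q, hq, rfl⟩, rfl⟩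
      obtain ⟨a, ha, hqa⟩ := mem_iUnion₂.1 (hs hq)
      obtain ⟨v, hv, rfl⟩ := hqa
      have h1 : v * x ∈ x • V := by rw [hVx x]; exact ⟨v, hv, rfl⟩
      refine mem_iUnion₂.2 ⟨a, ha, ?_⟩
      rw [← smul_smul]
      refine ⟨a * (v * x), ⟨v * x, h1, rfl⟩, by simp [mul_assoc]⟩
  rw [ampInt]
  simp only [localSup_rightTrans]
  refine this.trans ?_
  calc _ ≤ (∑ a ∈ s, (m a⁻¹ : ℝ≥0∞) ^ r * (m x⁻¹ : ℝ≥0∞) ^ r) * (C * ampInt μ m r F Q) := by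
        gcongr with a ha
        · rw [← ENNReal.mul_rpow_of_nonneg _ _ hr.le]
          refine ENNReal.rpow_le_rpow ?_ hr.le
          rw [mul_inv_rev, mul_comm]
          exact_mod_cast hm.submul x⁻¹ a⁻¹
        · exact hC F hF
    _ = _ := by
        rw [← Finset.sum_mul]
        push_cast
        simp only [← ENNReal.coe_rpow_of_nonneg _ hr.le]
        ring

end Group

/-! ### Translation operators on amalgam spaces -/

section Operators

variable {G : Type*} [Group G] [TopologicalSpace G] [IsTopologicalGroup G]
  [LocallyCompactSpace G] [T2Space G] [MeasurableSpace G] [BorelSpace G]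
  {μ : Measure G} [μ.IsHaarMeasure] [μ.Regular] {m : G → ℝ≥0} {p : ℝ≥0∞} {F : G → ℂ} {Q : Set G}

theorem toReal_pos_of_le_one (hp0 : 0 < p) (hp1 : p ≤ 1) : 0 < p.toReal :=
  ENNReal.toReal_pos hp0.ne' (hp1.trans_lt ENNReal.one_lt_top).ne

theorem toReal_le_one (hp1 : p ≤ 1) : p.toReal ≤ 1 :=
  ENNReal.toReal_le_of_le_ofReal zero_le_one (by simpa using hp1)

theorem LocLinfty.aestronglyMeasurable (hF : LocLinfty μ F) (C : Set G) (hC : IsCompact C) :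
    AEStronglyMeasurable F (μ.restrict C) := (hF C hC).1

theorem amalgamNorm_eq (hp0 : 0 < p) (hp1 : p ≤ 1) :
    amalgamNorm μ Q m p F = ampInt μ m p.toReal F Q ^ (1 / p.toReal) := by
  rw [amalgamNorm, wLpNorm,
    eLpNorm_eq_lintegral_rpow_enorm_toReal hp0.ne' (hp1.trans_lt ENNReal.one_lt_top).ne]
  rfl

/-- The control function of a locally bounded function is lower semicontinuous, so measurability is
automatic and only finiteness remains. -/
theorem memAmalgam_iff [μ.IsMulRightInvariant] (hm : Measurable m) (hQ : IsWindow Q)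
    (hp0 : 0 < p) (hp1 : p ≤ 1) :
    MemAmalgam μ Q m p F ↔ LocLinfty μ F ∧ ampInt μ m p.toReal F Q < ∞ := by
  refine and_congr_right fun hF => ?_
  have hr := toReal_pos_of_le_one hp0 hp1
  have h1 : eLpNorm (fun x => m x • controlFn μ Q F x) p μ =
      ampInt μ m p.toReal F Q ^ (1 / p.toReal) := amalgamNorm_eq hp0 hp1
  rw [MemWLp, MemLp, h1, ENNReal.rpow_lt_top_iff_of_pos (by positivity)]
  refine and_iff_right ?_
  refine (Measurable.stronglyMeasurable ?_).aestronglyMeasurable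
  exact (measurable_coe_nnreal_ennreal.comp hm).mul
    (lowerSemicontinuous_localSup_left hF.aestronglyMeasurable hQ.measurableSet
      hQ.relCompact).measurable

theorem LocLinfty.comp_homeomorph (hF : LocLinfty μ F) (e : G ≃ₜ G)
    (he : MeasurePreserving e μ μ) : LocLinfty μ (F ∘ e) := by
  intro C hC
  have h1 := he.restrict_image_emb e.measurableEmbedding C
  exact (hF _ (hC.image e.continuous)).comp_measurePreserving h1

theorem LocLinfty.leftTrans (hF : LocLinfty μ F) (x : G) : LocLinfty μ (leftTrans x F) :=
  hF.comp_homeomorph (Homeomorph.mulLeft x⁻¹) (measurePreserving_mul_left μ x⁻¹)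

theorem LocLinfty.rightTrans [μ.IsMulRightInvariant] (hF : LocLinfty μ F) (x : G) :
    LocLinfty μ (rightTrans x F) :=
  hF.comp_homeomorph (Homeomorph.mulRight x) (measurePreserving_mul_right μ x)

theorem locLinfty_of_continuous (hF : Continuous F) : LocLinfty μ F := by
  intro C hC
  obtain ⟨B, hB⟩ := hC.exists_bound_of_continuousOn hF.continuousOn
  exact memLp_top_of_bound hF.aestronglyMeasurable B
    (ae_restrict_of_forall_mem hC.measurableSet hB)

theorem opNorm_le_of_ampInt_le (hp0 : 0 < p) (hp1 : p ≤ 1) {T : (G → ℂ) → (G → ℂ)} {K : ℝ≥0∞}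
    (h : ∀ F, MemAmalgam μ Q m p F →
      ampInt μ m p.toReal (T F) Q ≤ K ^ p.toReal * ampInt μ m p.toReal F Q) :
    opNorm μ Q m p T ≤ K := by
  have hr := toReal_pos_of_le_one hp0 hp1
  refine sInf_le fun F hF => ?_
  rw [amalgamNorm_eq hp0 hp1, amalgamNorm_eq hp0 hp1]
  refine (ENNReal.rpow_le_rpow (h F hF) (by positivity)).trans (le_of_eq ?_)
  rw [ENNReal.mul_rpow_of_nonneg _ _ (by positivity), ← ENNReal.rpow_mul,
    mul_one_div_cancel hr.ne', ENNReal.rpow_one]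

theorem amalgamNorm_le_opNorm_mul {T : (G → ℂ) → (G → ℂ)} (hT : opNorm μ Q m p T < ∞)
    (hF : MemAmalgam μ Q m p F) :
    amalgamNorm μ Q m p (T F) ≤ opNorm μ Q m p T * amalgamNorm μ Q m p F := by
  obtain ⟨c, hc, -⟩ := sInf_lt_iff.1 hT
  have hfin : amalgamNorm μ Q m p F ≠ ∞ := hF.2.2.ne
  by_cases h0 : amalgamNorm μ Q m p F = 0
  · have := hc F hF
    rw [h0, mul_zero] at this ⊢
    exact this
  · rw [← ENNReal.div_le_iff h0 hfin]
    refine le_sInf fun c hc => ?_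
    rw [ENNReal.div_le_iff h0 hfin]
    exact hc F hF

/-- Each sublevel set is an intersection, over all F in the space, of closed sets. This is the route
to measurability of the two operator-norm weights, whose continuity is not available. -/
theorem lowerSemicontinuous_opNorm {T : G → (G → ℂ) → (G → ℂ)}
    (hT : ∀ x, opNorm μ Q m p (T x) < ∞)
    (h : ∀ F, MemAmalgam μ Q m p F → LowerSemicontinuous fun x => amalgamNorm μ Q m p (T x F)) :
    LowerSemicontinuous fun x => opNorm μ Q m p (T x) := by
  rw [lowerSemicontinuous_iff_isClosed_preimage]
  intro C
  have : (fun x => opNorm μ Q m p (T x)) ⁻¹' Iic C = ⋂ F : {F // MemAmalgam μ Q m p F},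
      (fun x => amalgamNorm μ Q m p (T x F)) ⁻¹' Iic (C * amalgamNorm μ Q m p F) := by
    ext x
    simp only [mem_preimage, mem_Iic, mem_iInter, Subtype.forall]
    refine ⟨fun hx F hF => (amalgamNorm_le_opNorm_mul (hT x) hF).trans (by gcongr),
      fun hx => sInf_le hx⟩
  rw [this]
  exact isClosed_iInter fun F => (h F F.2).isClosed_preimage _

variable [μ.IsMulRightInvariant]

theorem opNorm_leftTrans_le (hm : IsSubmulWeight m) (hp0 : 0 < p) (hp1 : p ≤ 1) (x : G) :
    opNorm μ Q m p (leftTrans x) ≤ m x :=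
  opNorm_le_of_ampInt_le hp0 hp1 fun _ _ =>
    ampInt_leftTrans_le hm (toReal_pos_of_le_one hp0 hp1) x Q

theorem exists_opNorm_rightTrans_le (hIN : IsINGroup G) (hm : IsSubmulWeight m)
    (hp0 : 0 < p) (hp1 : p ≤ 1) (hQ : IsWindow Q) :
    ∃ C : ℝ≥0, ∀ x, opNorm μ Q m p (rightTrans x) ≤ C * m x⁻¹ := by
  have hr := toReal_pos_of_le_one hp0 hp1
  obtain ⟨C, hC⟩ := exists_ampInt_rightTrans_le (μ := μ) hIN hm hr (toReal_le_one hp1) hQ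
  refine ⟨C ^ (1 / p.toReal), fun x => opNorm_le_of_ampInt_le hp0 hp1 fun F hF => ?_⟩
  rw [ENNReal.mul_rpow_of_nonneg _ _ hr.le, ENNReal.coe_rpow_of_nonneg _ (by positivity),
    ← ENNReal.rpow_mul, one_div_mul_cancel hr.ne', ENNReal.rpow_one]
  exact hC x F hF.1.aestronglyMeasurable

theorem boundedOnAmalgam_leftTrans (hm : IsSubmulWeight m) (hp0 : 0 < p) (hp1 : p ≤ 1)
    (hQ : IsWindow Q) (x : G) : BoundedOnAmalgam μ Q m p (leftTrans x) := by
  have hr := toReal_pos_of_le_one hp0 hp1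
  refine ⟨fun F hF => ?_, (opNorm_leftTrans_le hm hp0 hp1 x).trans_lt ENNReal.coe_lt_top⟩
  rw [memAmalgam_iff hm.continuous.measurable hQ hp0 hp1] at hF ⊢
  refine ⟨hF.1.leftTrans x, (ampInt_leftTrans_le hm hr x Q).trans_lt ?_⟩
  exact ENNReal.mul_lt_top (ENNReal.rpow_lt_top_of_nonneg hr.le (by simp)) hF.2

theorem boundedOnAmalgam_rightTrans (hIN : IsINGroup G) (hm : IsSubmulWeight m) (hp0 : 0 < p)
    (hp1 : p ≤ 1) (hQ : IsWindow Q) (x : G) : BoundedOnAmalgam μ Q m p (rightTrans x) := by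
  have hr := toReal_pos_of_le_one hp0 hp1
  obtain ⟨C, hC⟩ := exists_opNorm_rightTrans_le (μ := μ) hIN hm hp0 hp1 hQ
  obtain ⟨D, hD⟩ := exists_ampInt_rightTrans_le (μ := μ) hIN hm hr (toReal_le_one hp1) hQ
  refine ⟨fun F hF => ?_, (hC x).trans_lt (ENNReal.mul_lt_top (by simp) (by simp))⟩
  rw [memAmalgam_iff hm.continuous.measurable hQ hp0 hp1] at hF ⊢
  refine ⟨hF.1.rightTrans x, (hD x F hF.1.aestronglyMeasurable).trans_lt ?_⟩
  exact ENNReal.mul_lt_top (ENNReal.mul_lt_top (by simp)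
    (ENNReal.rpow_lt_top_of_nonneg hr.le (by simp))) hF.2

/-- Both kinds of translation act on local suprema by moving the window to a two-sided translate
depending continuously on (x, y). Joint lower semicontinuity then survives integration in y. -/
theorem lowerSemicontinuous_opNorm_of_localSup (hm : IsSubmulWeight m) (hp0 : 0 < p) (hp1 : p ≤ 1)
    (hQ : IsWindow Q) {T : G → (G → ℂ) → (G → ℂ)} {g : G × G → G × G} (hg : Continuous g)
    (hTg : ∀ x y F, localSup μ (T x F) (y • Q) =
      localSup μ F ((fun q => (g (x, y)).1 * q * (g (x, y)).2) '' Q))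
    (hT : ∀ x, BoundedOnAmalgam μ Q m p (T x)) :
    LowerSemicontinuous fun x => opNorm μ Q m p (T x) := by
  have hr := toReal_pos_of_le_one hp0 hp1
  refine lowerSemicontinuous_opNorm (fun x => (hT x).2) fun F hF => ?_
  simp only [amalgamNorm_eq hp0 hp1]
  refine lowerSemicontinuous_rpow (by positivity) ?_
  simp only [ampInt, hTg]
  refine lowerSemicontinuous_lintegral_of_prod μ (Φ := fun z : G × G => ((m z.2 : ℝ≥0∞) *
    localSup μ F ((fun q => (g z).1 * q * (g z).2) '' Q)) ^ p.toReal) ?_ fun x => ?_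
  · refine lowerSemicontinuous_rpow hr.le ?_
    refine lowerSemicontinuous_coe_mul (hm.continuous.comp continuous_snd) (fun z => hm.pos z.2) ?_
    exact (lowerSemicontinuous_localSup hF.1.aestronglyMeasurable hQ.measurableSet
      hQ.relCompact).comp hg
  · have := ((memAmalgam_iff hm.continuous.measurable hQ hp0 hp1).1 ((hT x).1 F hF)).2.ne
    simpa only [ampInt, hTg] using this

theorem measurable_leftWeight (hm : IsSubmulWeight m) (hp0 : 0 < p) (hp1 : p ≤ 1)
    (hQ : IsWindow Q) : Measurable (leftWeight μ Q m p) := by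
  have h : LowerSemicontinuous fun x => opNorm μ Q m p (leftTrans x⁻¹) := by
    refine lowerSemicontinuous_opNorm_of_localSup hm hp0 hp1 hQ
      (T := fun x => leftTrans x⁻¹) (g := fun z => (z.1 * z.2, 1)) (by fun_prop)
      (fun x y F => ?_) fun x => boundedOnAmalgam_leftTrans hm hp0 hp1 hQ _
    rw [localSup_leftTrans, inv_inv, smul_smul, ← image_smul]
    simp
  exact (measurable_const.max h.measurable).ennreal_toNNReal

theorem measurable_rightWeight (hIN : IsINGroup G) (hm : IsSubmulWeight m) (hp0 : 0 < p)
    (hp1 : p ≤ 1) (hQ : IsWindow Q) : Measurable (rightWeight μ Q m p) := by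
  have h : LowerSemicontinuous fun x => opNorm μ Q m p (rightTrans x) := by
    refine lowerSemicontinuous_opNorm_of_localSup hm hp0 hp1 hQ
      (T := rightTrans) (g := fun z => (z.2, z.1)) (by fun_prop)
      (fun x y F => ?_) fun x => boundedOnAmalgam_rightTrans hIN hm hp0 hp1 hQ _
    rw [localSup_rightTrans, ← image_smul, image_image]
    simp
  have h' : rightWeight μ Q m p = fun x => (max (opNorm μ Q m p (rightTrans x))
      (opNorm μ Q m p (rightTrans x⁻¹))).toNNReal := by
    ext x
    rw [rightWeight, modulus_eq_one μ hIN, ENNReal.coe_one, one_mul]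
  rw [h']
  exact (h.measurable.max (h.measurable.comp measurable_inv)).ennreal_toNNReal

/-- The translation operators have norms bounded below by the weight. -/
theorem exists_le_opNorm (hIN : IsINGroup G) (hm : IsSubmulWeight m) (hsymm : ∀ x, m x⁻¹ = m x)
    (hp0 : 0 < p) (hp1 : p ≤ 1) (hQ : IsWindow Q) :
    ∃ C : ℝ≥0, ∀ x, (m x : ℝ≥0∞) ≤ C * opNorm μ Q m p (leftTrans x⁻¹) ∧
      (m x : ℝ≥0∞) ≤ C * opNorm μ Q m p (rightTrans x) := by
  have hr := toReal_pos_of_le_one hp0 hp1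
  obtain ⟨V, hVc, hV, hVx⟩ := hIN.exists_window
  -- By conjugation invariance of V, both `leftTrans x⁻¹` and `rightTrans x` send this indicator to
  -- the indicator of x⁻¹V, so one test function handles both bounds.
  set F : G → ℂ := V.indicator 1
  have hF1 : ∀ y, ‖F y‖ₑ ≤ 1 := fun y => by
    by_cases hy : y ∈ V <;> simp [F, hy]
  have hmem : MemAmalgam μ Q m p F := by
    rw [memAmalgam_iff hm.continuous.measurable hQ hp0 hp1]
    refine ⟨fun C hC => ?_, ?_⟩
    · refine memLp_top_of_bound ((aestronglyMeasurable_const (b := (1 : ℂ))).indicator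
        hV.measurableSet) 1 (.of_forall fun y => ?_)
      by_cases hy : y ∈ V <;> simp [F, hy]
    · have hK : IsCompact (V * (closure Q)⁻¹) := hVc.mul hQ.relCompact.inv
      obtain ⟨B, hB⟩ := hK.bddAbove_image hm.continuous.continuousOn
      calc ampInt μ m p.toReal F Q
          ≤ ∫⁻ y, (V * (closure Q)⁻¹).indicator (fun _ => (B : ℝ≥0∞) ^ p.toReal) y ∂μ := by
            refine lintegral_mono fun y => ?_
            by_cases hy : y ∈ V * (closure Q)⁻¹
            · rw [indicator_of_mem hy]
              refine ENNReal.rpow_le_rpow ?_ hr.le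
              calc (m y : ℝ≥0∞) * localSup μ F (y • Q) ≤ B * 1 := by
                    gcongr
                    · exact hB ⟨y, hy, rfl⟩
                    · exact localSup_le_iff.2 (.of_forall hF1)
                _ = B := mul_one _
            · rw [indicator_of_notMem hy]
              have : localSup μ F (y • Q) ≤ 0 := by
                refine localSup_le_of_forall (hQ.measurableSet.const_smul y) ?_
                rintro _ ⟨q, hq, rfl⟩
                have : y * q ∉ V := fun h => hy
                  ⟨y * q, h, q⁻¹, inv_mem_inv.2 (subset_closure hq), by simp⟩
                simp [F, this]
              rw [nonpos_iff_eq_zero.1 this, mul_zero, ENNReal.zero_rpow_of_pos hr]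
        _ ≤ (B : ℝ≥0∞) ^ p.toReal * μ (V * (closure Q)⁻¹) := lintegral_indicator_const_le _ _
        _ < ∞ := ENNReal.mul_lt_top (ENNReal.rpow_lt_top_of_nonneg hr.le (by simp))
            hK.measure_lt_top
  obtain ⟨D, hD⟩ := hVc.bddAbove_image hm.continuous.continuousOn
  have h1V : (1 : G) ∈ V := mem_of_mem_nhds hV.mem_nhds
  have hD0 : 0 < D := (hm.pos 1).trans_le (hD ⟨1, h1V, rfl⟩)
  have hμ0 : μ (interior V) ≠ 0 :=
    (isOpen_interior.measure_pos μ ⟨1, mem_interior_iff_mem_nhds.2 hV.mem_nhds⟩).ne'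
  have hμt : μ (interior V) ≠ ∞ :=
    ((measure_mono interior_subset).trans_lt hVc.measure_lt_top).ne
  -- On x⁻¹V the weight is at least m(x)/D, by submultiplicativity and symmetry, and the control
  -- function of F' is at least 1 on x⁻¹ times the interior of V.
  have hlow : ∀ x, ∀ F' : G → ℂ, (∀ y ∈ V, ‖F' (x⁻¹ * y)‖ₑ = 1) →
      (m x : ℝ≥0∞) ≤ D * (μ (interior V) ^ (1 / p.toReal))⁻¹ * amalgamNorm μ Q m p F' := by
    intro x F' hF'
    rw [amalgamNorm_eq hp0 hp1]
    have hle : ((m x / D : ℝ≥0) : ℝ≥0∞) ^ p.toReal * μ (interior V) ≤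
        ampInt μ m p.toReal F' Q := by
      rw [← measure_smul μ x⁻¹ (interior V), ← setLIntegral_const]
      refine (setLIntegral_mono' (isOpen_interior.smul x⁻¹).measurableSet ?_).trans
        (setLIntegral_le_lintegral _ _)
      rintro _ ⟨v, hv, rfl⟩
      refine ENNReal.rpow_le_rpow ?_ hr.le
      have h1 : 1 ≤ localSup μ F' ((x⁻¹ • v) • Q) := by
        refine le_localSup_of_eventually (y := x⁻¹ • v) ?_ (by
          simpa using smul_mem_nhds_smul (x⁻¹ • v) hQ.mem_nhds)
        filter_upwards [(isOpen_interior.smul x⁻¹).mem_nhds (smul_mem_smul_set hv)]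
        rintro _ ⟨u, hu, rfl⟩
        exact (hF' u (interior_subset hu)).ge
      calc ((m x / D : ℝ≥0) : ℝ≥0∞) ≤ m (x⁻¹ • v) * 1 := by
            rw [mul_one, ENNReal.coe_le_coe, div_le_iff₀ hD0]
            calc m x = m ((x⁻¹ • v) * v⁻¹) := by rw [smul_eq_mul, mul_inv_cancel_right, hsymm]
              _ ≤ m (x⁻¹ • v) * m v⁻¹ := hm.submul _ _
              _ ≤ m (x⁻¹ • v) * D := by
                rw [hsymm]
                gcongr
                exact hD ⟨v, interior_subset hv, rfl⟩
        _ ≤ _ := by gcongr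
    have h2 := ENNReal.rpow_le_rpow hle (z := 1 / p.toReal) (by positivity)
    rw [ENNReal.mul_rpow_of_nonneg _ _ (by positivity), ← ENNReal.rpow_mul,
      mul_one_div_cancel hr.ne', ENNReal.rpow_one] at h2
    have hμ0' : μ (interior V) ^ (1 / p.toReal) ≠ 0 := by
      simp [ENNReal.rpow_eq_zero_iff, hμ0, hμt]
    have hμt' : μ (interior V) ^ (1 / p.toReal) ≠ ∞ :=
      ENNReal.rpow_ne_top_of_nonneg (by positivity) hμt
    rw [← ENNReal.le_div_iff_mul_le (.inl hμ0') (.inl hμt')] at h2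
    calc (m x : ℝ≥0∞) = D * ((m x / D : ℝ≥0) : ℝ≥0∞) := by
          rw [← ENNReal.coe_mul, mul_div_cancel₀ _ hD0.ne']
      _ ≤ D * (ampInt μ m p.toReal F' Q ^ (1 / p.toReal) / μ (interior V) ^ (1 / p.toReal)) := by
          gcongr
      _ = _ := by rw [div_eq_mul_inv]; ring
  have hCfin : D * (μ (interior V) ^ (1 / p.toReal))⁻¹ * amalgamNorm μ Q m p F ≠ ∞ := by
    refine ENNReal.mul_ne_top (ENNReal.mul_ne_top (by simp) (ENNReal.inv_ne_top.2 ?_)) hmem.2.2.ne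
    simp [ENNReal.rpow_eq_zero_iff, hμ0, hμt]
  refine ⟨(D * (μ (interior V) ^ (1 / p.toReal))⁻¹ * amalgamNorm μ Q m p F).toNNReal,
    fun x => ?_⟩
  rw [ENNReal.coe_toNNReal hCfin]
  have hfin : ∀ T, BoundedOnAmalgam μ Q m p T → (∀ y ∈ V, ‖T F (x⁻¹ * y)‖ₑ = 1) →
      (m x : ℝ≥0∞) ≤ D * (μ (interior V) ^ (1 / p.toReal))⁻¹ * amalgamNorm μ Q m p F *
        opNorm μ Q m p T := by
    intro T hT h
    refine (hlow x (T F) h).trans ?_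
    rw [mul_assoc _ (amalgamNorm μ Q m p F), mul_comm (amalgamNorm μ Q m p F)]
    gcongr
    exact amalgamNorm_le_opNorm_mul hT.2 hmem
  refine ⟨hfin _ (boundedOnAmalgam_leftTrans hm hp0 hp1 hQ _) fun y hy => ?_,
    hfin _ (boundedOnAmalgam_rightTrans hIN hm hp0 hp1 hQ _) fun y hy => ?_⟩
  · simp [leftTrans, F, hy]
  · have : y ∈ (fun q => x * q) '' ((fun q => q * x⁻¹) '' V) := by
      rw [← hVx x⁻¹]
      exact ⟨x⁻¹ * y, ⟨y, hy, rfl⟩, by simp⟩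
    obtain ⟨_, ⟨v, hv, rfl⟩, hvy⟩ := this
    have : x⁻¹ * y * x = v := by rw [← hvy]; group
    simp [rightTrans, F, this, hv]

/-- The weights attached to `W(L^∞, L^p_m)` are equivalent to `m` when `m` is symmetric. -/
theorem exists_weight_equiv (hIN : IsINGroup G) (hm : IsSubmulWeight m)
    (hsymm : ∀ x, m x⁻¹ = m x) (hone : ∀ x, 1 ≤ m x)
    (hp0 : 0 < p) (hp1 : p ≤ 1) (hQ : IsWindow Q) :
    ∃ C : ℝ≥0, ∀ x, m x ≤ C * leftWeight μ Q m p x ∧ leftWeight μ Q m p x ≤ C * m x ∧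
      m x ≤ C * rightWeight μ Q m p x ∧ rightWeight μ Q m p x ≤ C * m x := by
  obtain ⟨C, hC⟩ := exists_le_opNorm (μ := μ) hIN hm hsymm hp0 hp1 hQ
  obtain ⟨D, hD⟩ := exists_opNorm_rightTrans_le (μ := μ) hIN hm hp0 hp1 hQ
  -- The hypothesis 1 ≤ m absorbs the constant 1 in the maximum. The bounds `hl` and `hr` also show
  -- that the maxima are finite, so `toNNReal` loses nothing.
  have hl : ∀ x, max 1 (opNorm μ Q m p (leftTrans x⁻¹)) ≤ m x := fun x =>
    max_le (by exact_mod_cast hone x) ((opNorm_leftTrans_le hm hp0 hp1 x⁻¹).trans (by rw [hsymm]))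
  have hr : ∀ x, max (opNorm μ Q m p (rightTrans x))
      (modulus x⁻¹ * opNorm μ Q m p (rightTrans x⁻¹)) ≤ D * m x := fun x => by
    rw [modulus_eq_one μ hIN, ENNReal.coe_one, one_mul]
    refine max_le ((hD x).trans (by rw [hsymm])) ((hD x⁻¹).trans (by rw [inv_inv]))
  have hlc : ∀ x, (leftWeight μ Q m p x : ℝ≥0∞) = max 1 (opNorm μ Q m p (leftTrans x⁻¹)) :=
    fun x => ENNReal.coe_toNNReal ((hl x).trans_lt ENNReal.coe_lt_top).ne
  have hrc : ∀ x, (rightWeight μ Q m p x : ℝ≥0∞) = max (opNorm μ Q m p (rightTrans x))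
      (modulus x⁻¹ * opNorm μ Q m p (rightTrans x⁻¹)) :=
    fun x => ENNReal.coe_toNNReal ((hr x).trans_lt
      (ENNReal.mul_lt_top ENNReal.coe_lt_top ENNReal.coe_lt_top)).ne
  refine ⟨max 1 (max C D), fun x => ⟨?_, ?_, ?_, ?_⟩⟩ <;> rw [← ENNReal.coe_le_coe] <;>
    push_cast
  · rw [hlc]
    refine (hC x).1.trans ?_
    gcongr
    · exact (le_max_left _ _).trans (le_max_right _ _)
    · exact le_max_right _ _
  · rw [hlc]
    refine (hl x).trans ?_
    exact le_mul_of_one_le_left zero_le (le_max_left _ _)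
  · rw [hrc]
    refine (hC x).2.trans ?_
    gcongr
    · exact (le_max_left _ _).trans (le_max_right _ _)
    · exact le_max_left _ _
  · rw [hrc]
    refine (hr x).trans ?_
    gcongr
    exact (le_max_right _ _).trans (le_max_right _ _)

end Operators

/-! ### Schur's lemma and cyclic vectors -/

section Schur

variable {G : Type*} [Group G] [TopologicalSpace G]
  {H : Type*} [NormedAddCommGroup H] [InnerProductSpace ℂ H] [CompleteSpace H]
  {π : G →* (H ≃ₗᵢ[ℂ] H)}

/-- Schur's lemma for self-adjoint intertwining operators. -/
theorem IsIrreducibleUnitaryRep.exists_eq_smul (hπ : IsIrreducibleUnitaryRep π) (A : H →L[ℂ] H)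
    (hA : IsSelfAdjoint A) (hcomm : ∀ x f, A (π x f) = π x (A f)) :
    ∃ α : ℝ, ∀ f, A f = (α : ℂ) • f := by
  have := hπ.nontrivial
  obtain ⟨a, ha⟩ : (spectrum ℝ A).Nonempty :=
    ContinuousFunctionalCalculus.spectrum_nonempty A hA
  -- Two spectral values separated by c would give nonzero operators φ(A), ψ(A) with product 0. The
  -- kernel of φ(A) is then a closed invariant subspace that contains the nonzero range of ψ(A) but
  -- is not all of H.
  have hsub : ∀ b ∈ spectrum ℝ A, b = a := by
    intro b hb
    by_contra hba
    wlog hlt : a < b generalizing a b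
    · exact this b hb a ha (Ne.symm hba) (lt_of_le_of_ne (not_lt.1 hlt) hba)
    obtain ⟨c, hac, hcb⟩ := exists_between hlt
    set φ : ℝ → ℝ := fun t => max 0 (t - c)
    set ψ : ℝ → ℝ := fun t => max 0 (c - t)
    have hφ : ContinuousOn φ (spectrum ℝ A) := by fun_prop
    have hψ : ContinuousOn ψ (spectrum ℝ A) := by fun_prop
    have hprod : cfc φ A * cfc ψ A = 0 := by
      rw [← cfc_mul φ ψ A hφ hψ]
      have : (fun t => φ t * ψ t) = fun _ => (0 : ℝ) := by
        ext t
        rcases le_total t c with h | h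
        · simp [φ, h]
        · simp [ψ, h]
      rw [this, cfc_const_zero]
    have hne : ∀ (χ : ℝ → ℝ), ContinuousOn χ (spectrum ℝ A) → (∃ t ∈ spectrum ℝ A, χ t ≠ 0) →
        cfc χ A ≠ 0 := by
      rintro χ hχ ⟨t, ht, hχt⟩ h0
      have h1 := cfc_map_spectrum χ A hA hχ
      rw [h0, spectrum.zero_eq] at h1
      exact hχt (h1.symm.subset ⟨t, ht, rfl⟩)
    have hφA := hne φ hφ ⟨b, hb, by simp [φ, hcb]⟩
    have hψA := hne ψ hψ ⟨a, ha, by simp [ψ, hac]⟩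
    have hcφ : ∀ x f, cfc φ A (π x f) = π x (cfc φ A f) := by
      intro x f
      have h1 : Commute A ((π x).toContinuousLinearEquiv : H →L[ℂ] H) := by
        ext f
        exact hcomm x f
      exact DFunLike.congr_fun (h1.cfc_real φ).eq f
    rcases hπ.irreducible (LinearMap.ker (cfc φ A).toLinearMap) (cfc φ A).isClosed_ker
        (fun x f hf => by
          rw [LinearMap.mem_ker] at hf ⊢
          exact (hcφ x f).trans (by rw [show cfc φ A f = 0 from hf, map_zero])) with h | h
    · refine hψA (ContinuousLinearMap.ext fun f => ?_)
      have h1 : cfc ψ A f ∈ LinearMap.ker (cfc φ A).toLinearMap :=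
        DFunLike.congr_fun hprod f
      rw [h] at h1
      exact h1
    · refine hφA (ContinuousLinearMap.ext fun f => ?_)
      have h1 : f ∈ LinearMap.ker (cfc φ A).toLinearMap := h ▸ Submodule.mem_top
      exact h1
  refine ⟨a, fun f => ?_⟩
  have h1 : A = algebraMap ℝ (H →L[ℂ] H) a := by
    rw [← cfc_const a A hA, ← cfc_id ℝ A hA]
    conv_rhs => rw [cfc_id ℝ A hA]
    exact cfc_congr fun b hb => hsub b hb
  rw [h1]
  simp [Algebra.algebraMap_eq_smul_one]

theorem map_map_inv (π : G →* (H ≃ₗᵢ[ℂ] H)) (x : G) (f : H) : π x (π x⁻¹ f) = f := by simp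

/-- A non-zero vector of an irreducible representation is cyclic. -/
theorem IsIrreducibleUnitaryRep.eq_zero_of_forall_inner (hπ : IsIrreducibleUnitaryRep π) {g u : H}
    (hg : g ≠ 0) (h : ∀ x, inner ℂ (π x g) u = 0) : u = 0 := by
  let S : Submodule ℂ H :=
    { carrier := {f | ∀ x, inner ℂ (π x g) f = 0}
      zero_mem' := by simp
      add_mem' := fun ha hb x => by rw [inner_add_right, ha x, hb x, add_zero]
      smul_mem' := fun c a ha x => by rw [inner_smul_right, ha x, mul_zero] }
  have hS : IsClosed (S : Set H) := by
    have : (S : Set H) = ⋂ x, {f | inner ℂ (π x g) f = 0} := by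
      ext f; simp [S]
    rw [this]
    exact isClosed_iInter fun x => isClosed_eq (by fun_prop) continuous_const
  rcases hπ.irreducible S hS (fun x f hf y => by
      have := hf (x⁻¹ * y)
      rw [← (π x).inner_map_map] at this
      simpa using this) with h1 | h1
  · have : u ∈ S := h
    rw [h1] at this
    exact this
  · have : g ∈ S := h1 ▸ Submodule.mem_top
    have := this 1
    simp only [map_one, LinearIsometryEquiv.coe_one, id] at this
    exact absurd (inner_self_eq_zero.1 this) hg

theorem IsIrreducibleUnitaryRep.exists_inner_ne_zero (hπ : IsIrreducibleUnitaryRep π) {g u : H}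
    (hg : g ≠ 0) (hu : u ≠ 0) : ∃ x, inner ℂ (π x g) u ≠ 0 := by
  by_contra! h
  exact hu (hπ.eq_zero_of_forall_inner hg h)

/-- A bounded intertwining operator from a unitary representation onto an irreducible one is a
multiple of a coisometry. -/
theorem IsIrreducibleUnitaryRep.exists_comp_adjoint_eq_smul (hπ : IsIrreducibleUnitaryRep π)
    {D : Type*} [NormedAddCommGroup D] [InnerProductSpace ℂ D] [CompleteSpace D] (ι : D →L[ℂ] H)
    (U : G → D → D) (hU : ∀ x e, ι (U x e) = π x (ι e))
    (hUinner : ∀ x k e, inner ℂ (U x k) e = inner ℂ k (U x⁻¹ e)) (hι : ∃ e, ι e ≠ 0) :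
    ∃ α : ℝ, (α : ℂ) ≠ 0 ∧ ∀ f, ι (ι.adjoint f) = (α : ℂ) • f := by
  have hP : IsSelfAdjoint (ι.comp ι.adjoint) := by
    rw [ContinuousLinearMap.isSelfAdjoint_iff', ContinuousLinearMap.adjoint_comp,
      ContinuousLinearMap.adjoint_adjoint]
  obtain ⟨α, hα⟩ := hπ.exists_eq_smul (ι.comp ι.adjoint) hP fun x f => by
    -- The adjoint intertwines too; of unitarity of U only the relation `hUinner` is needed.
    have key : ι.adjoint (π x f) = U x (ι.adjoint f) := by
      refine ext_inner_left ℂ fun k => ?_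
      have h1 := hUinner x⁻¹ k (ι.adjoint f)
      rw [inv_inv] at h1
      rw [← h1, ContinuousLinearMap.adjoint_inner_right, ContinuousLinearMap.adjoint_inner_right,
        hU, ← (π x).inner_map_map (π x⁻¹ (ι k)), map_map_inv]
    rw [ContinuousLinearMap.comp_apply, key, hU, ContinuousLinearMap.comp_apply]
  refine ⟨α, fun h0 => ?_, hα⟩
  obtain ⟨e, he⟩ := hι
  have h1 : ι.adjoint (ι e) = 0 := by
    rw [← inner_self_eq_zero (𝕜 := ℂ), ContinuousLinearMap.adjoint_inner_left]
    have := hα (ι e)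
    rw [ContinuousLinearMap.comp_apply] at this
    rw [this, h0, zero_smul, inner_zero_right]
  refine he (inner_self_eq_zero (𝕜 := ℂ).1 ?_)
  rw [← ContinuousLinearMap.adjoint_inner_left, h1, inner_zero_left]

end Schur

/-! ### Elementary identities for voice transforms -/

section Voice

variable {G : Type*} [Group G] {H : Type*} [NormedAddCommGroup H] [InnerProductSpace ℂ H]
  (π : G →* (H ≃ₗᵢ[ℂ] H))

theorem voice_map (g f : H) (x y : G) : voice π g (π x f) y = voice π g f (x⁻¹ * y) := by
  rw [voice, voice, ← (π x).inner_map_map (π (x⁻¹ * y) g)]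
  simp

theorem voice_inv (g f : H) (x : G) : voice π g f x⁻¹ = starRingEnd ℂ (voice π f g x) := by
  rw [voice, voice, inner_conj_symm, ← (π x).inner_map_map]
  simp

theorem norm_voice_le (g f : H) (x : G) : ‖voice π g f x‖ ≤ ‖g‖ * ‖f‖ := by
  simpa [voice] using norm_inner_le_norm (π x g) f

theorem voice_one (g f : H) : voice π g f 1 = inner ℂ g f := by simp [voice]

variable {π}

theorem IsIrreducibleUnitaryRep.continuous_voice [TopologicalSpace G]
    (hπ : IsIrreducibleUnitaryRep π) (g f : H) : Continuous (voice π g f) :=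
  (hπ.strongly_continuous g).inner continuous_const

theorem IsIrreducibleUnitaryRep.aestronglyMeasurable_voice [TopologicalSpace G]
    [MeasurableSpace G] [BorelSpace G] {μ : Measure G} (hπ : IsIrreducibleUnitaryRep π)
    (g f : H) : AEStronglyMeasurable (voice π g f) μ :=
  (hπ.continuous_voice g f).aestronglyMeasurable

end Voice

/-- The graph of a pointwise continuous map from a normed space to `L^p` is closed. -/
theorem isClosed_graph_Lp {X E : Type*} [MeasurableSpace X] {μ : Measure X}
    [NormedAddCommGroup E] {p : ℝ≥0∞} [Fact (1 ≤ p)] {T : E → X → ℂ}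
    (hT : ∀ x, Continuous fun f => T f x) :
    IsClosed {e : E × Lp ℂ p μ | e.2 =ᵐ[μ] T e.1} := by
  refine IsSeqClosed.isClosed fun e e₀ he hlim => ?_
  -- Convergence in L^p gives an almost everywhere convergent subsequence, whose limit is then
  -- identified pointwise.
  obtain ⟨ns, hns, hae⟩ := (tendstoInMeasure_of_tendsto_Lp
    ((continuous_snd.tendsto _).comp hlim)).exists_seq_tendsto_ae
  have h1 : ∀ᵐ x ∂μ, ∀ n, (e n).2 x = T (e n).1 x := ae_all_iff.2 he
  filter_upwards [hae, h1] with x hx h1x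
  refine tendsto_nhds_unique hx ?_
  have h2 := ((hT x).tendsto e₀.1).comp (((continuous_fst.tendsto _).comp hlim).comp
    hns.tendsto_atTop)
  refine h2.congr fun n => ?_
  simp [h1x]

/-! ### Orthogonality relations -/

section Orthogonality

variable {G : Type*} [Group G] [TopologicalSpace G] [IsTopologicalGroup G]
  [LocallyCompactSpace G] [T2Space G] [MeasurableSpace G] [BorelSpace G]
  {μ : Measure G} [μ.IsHaarMeasure] [μ.Regular]
  {H : Type*} [NormedAddCommGroup H] [InnerProductSpace ℂ H] [CompleteSpace H]
  {π : G →* (H ≃ₗᵢ[ℂ] H)}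

variable (μ π) in
/-- The graph of the voice transform `f ↦ V_g f`, with domain `{f | V_g f ∈ L²}`. -/
def voiceGraph (g : H) : Submodule ℂ (WithLp 2 (H × Lp ℂ 2 μ)) where
  carrier := {e | e.snd =ᵐ[μ] voice π g e.fst}
  zero_mem' := by
    change _ =ᵐ[μ] _
    filter_upwards [Lp.coeFn_zero ℂ 2 μ] with x hx
    have h3 : (0 : WithLp 2 (H × Lp ℂ 2 μ)).fst = 0 := rfl
    have h4 : (0 : WithLp 2 (H × Lp ℂ 2 μ)).snd = 0 := rfl
    rw [h4, hx, h3]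
    simp [voice]
  add_mem' {a b} ha hb := by
    change _ =ᵐ[μ] _ at ha hb ⊢
    filter_upwards [Lp.coeFn_add a.snd b.snd, ha, hb] with x hx h1 h2
    have h3 : (a + b).fst = a.fst + b.fst := rfl
    have h4 : (a + b).snd = a.snd + b.snd := rfl
    rw [h4, hx, Pi.add_apply, h1, h2, h3]
    simp [voice]
  smul_mem' c a ha := by
    change _ =ᵐ[μ] _ at ha ⊢
    filter_upwards [Lp.coeFn_smul c a.snd, ha] with x hx h1
    have h3 : (c • a).fst = c • a.fst := rfl
    have h4 : (c • a).snd = c • a.snd := rfl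
    rw [h4, hx, Pi.smul_apply, h1, h3]
    simp [voice]

theorem isClosed_voiceGraph (g : H) : IsClosed (voiceGraph μ π g : Set (WithLp 2 (H × Lp ℂ 2 μ))) :=
  (isClosed_graph_Lp (μ := μ) (p := 2) (T := voice π g) fun x => by unfold voice; fun_prop).preimage
    (f := fun e : WithLp 2 (H × Lp ℂ 2 μ) => (e.fst, e.snd)) (by fun_prop)

theorem memLp_voice_map {g f : H} {p : ℝ≥0∞} (h : MemLp (voice π g f) p μ) (x : G) :
    MemLp (voice π g (π x f)) p μ := by
  have := h.comp_measurePreserving (measurePreserving_mul_left μ x⁻¹)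
  exact this.ae_eq (.of_forall fun y => (voice_map π g f x y).symm)

theorem memLp_voice_swap [μ.IsInvInvariant] (hπ : IsIrreducibleUnitaryRep π) {g f : H} {p : ℝ≥0∞}
    (h : MemLp (voice π g f) p μ) : MemLp (voice π f g) p μ := by
  refine (h.comp_measurePreserving (Measure.measurePreserving_inv μ)).of_le
    (hπ.aestronglyMeasurable_voice f g) (.of_forall fun x => ?_)
  simp [voice_inv]

/-- If `V_g f` is square integrable for some non-zero `f`, then for all `f`, and `V_g` is a multiple
of an isometry. -/
theorem IsIrreducibleUnitaryRep.exists_inner_voice (hπ : IsIrreducibleUnitaryRep π) {g f₀ : H}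
    (hf₀ : f₀ ≠ 0) (h₀ : MemLp (voice π g f₀) 2 μ) :
    ∃ c : ℝ, ∀ f h, MemLp (voice π g f) 2 μ ∧
      ∫ x, starRingEnd ℂ (voice π g f x) * voice π g h x ∂μ = c * inner ℂ f h := by
  have hcompl : CompleteSpace (voiceGraph μ π g) := (isClosed_voiceGraph g).completeSpace_coe
  -- The closed graph is a Hilbert space with inner product ⟨f, h⟩ + ⟨V_g f, V_g h⟩, invariant under
  -- G. Its projection to H is a bounded intertwiner even though V_g itself is not known to be
  -- everywhere defined.
  let ι : voiceGraph μ π g →L[ℂ] H :=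
    (WithLp.fstL 2 ℂ H (Lp ℂ 2 μ)).comp (voiceGraph μ π g).subtypeL
  obtain ⟨mk, hmk⟩ : ∃ mk : ∀ f, MemLp (voice π g f) 2 μ → voiceGraph μ π g,
      ∀ f hf, ι (mk f hf) = f :=
    ⟨fun f hf => ⟨WithLp.toLp 2 (f, hf.toLp), hf.coeFn_toLp⟩, fun f hf => rfl⟩
  have hmem : ∀ e, MemLp (voice π g (ι e)) 2 μ := fun e =>
    (memLp_congr_ae e.2).1 (Lp.memLp _)
  have hinner : ∀ e e' : voiceGraph μ π g, inner ℂ e e' = inner ℂ (ι e) (ι e') +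
      ∫ x, starRingEnd ℂ (voice π g (ι e) x) * voice π g (ι e') x ∂μ := by
    intro e e'
    rw [Submodule.coe_inner, WithLp.prod_inner_apply, L2.inner_def]
    congr 1
    refine integral_congr_ae ?_
    filter_upwards [e.2, e'.2] with x hx hx'
    change inner ℂ ((e : WithLp 2 (H × Lp ℂ 2 μ)).snd x) ((e' : WithLp 2 (H × Lp ℂ 2 μ)).snd x) = _
    rw [hx, hx', RCLike.inner_apply, mul_comm]
    rfl
  clear_value ι
  obtain ⟨α, hα0, hα⟩ := hπ.exists_comp_adjoint_eq_smul ι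
    (fun x e => mk (π x (ι e)) (memLp_voice_map (hmem e) x)) (fun x e => hmk _ _)
    (fun x k e => by
      rw [hinner, hinner, hmk, hmk]
      congr 1
      · rw [← (π x).inner_map_map (ι k), map_map_inv]
      · rw [← integral_mul_left_eq_self _ x]
        simp only [voice_map, inv_mul_cancel_left, inv_inv])
    ⟨mk f₀ h₀, by rwa [hmk]⟩
  -- As ι ι* is a nonzero scalar, ι is onto, so the domain of V_g is all of H.
  have hall : ∀ f, MemLp (voice π g f) 2 μ := by
    intro f
    have h1 := hmem ((α : ℂ)⁻¹ • ι.adjoint f)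
    rwa [map_smul, hα, inv_smul_smul₀ hα0] at h1
  -- The graph inner product equals α⁻¹⟨f, h⟩, and subtracting the summand ⟨f, h⟩ leaves the L²
  -- part.
  refine ⟨α⁻¹ - 1, fun f h => ⟨hall f, ?_⟩⟩
  have h1 := ContinuousLinearMap.adjoint_inner_right ι (mk f (hall f)) h
  rw [hinner, hmk, hα] at h1
  have h3 : ∀ x, voice π g ((α : ℂ) • h) x = α * voice π g h x := fun x => by
    simp [voice]
  simp only [h3, inner_smul_right, mul_left_comm _ (α : ℂ), integral_const_mul] at h1
  push_cast
  refine mul_left_cancel₀ hα0 ?_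
  linear_combination h1 - inner ℂ f h * mul_inv_cancel₀ hα0

/-- The orthogonality relations for square integrable irreducible representations of unimodular
groups. -/
theorem IsIrreducibleUnitaryRep.exists_orthogonality [μ.IsInvInvariant]
    (hπ : IsIrreducibleUnitaryRep π) {g₀ : H} (hg₀ : g₀ ≠ 0) (h₀ : MemLp (voice π g₀ g₀) 2 μ) :
    ∃ c : ℂ, c ≠ 0 ∧ ∀ a f, MemLp (voice π a f) 2 μ ∧ ∀ b h,
      ∫ x, starRingEnd ℂ (voice π a f x) * voice π b h x ∂μ = c * inner ℂ f h * inner ℂ b a := by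
  obtain ⟨c₀, hc₀⟩ := hπ.exists_inner_voice hg₀ h₀
  have hex : ∀ a : H, ∃ c : ℝ, ∀ f h, MemLp (voice π a f) 2 μ ∧
      ∫ x, starRingEnd ℂ (voice π a f x) * voice π a h x ∂μ = c * inner ℂ f h := fun a =>
    hπ.exists_inner_voice hg₀ (memLp_voice_swap hπ (hc₀ a 0).1)
  choose c hc using hex
  have hmem : ∀ a f, MemLp (voice π a f) 2 μ := fun a f => (hc a f 0).1
  -- Inversion exchanges V_a b and V_b a up to conjugation, so their L² norms agree and c(a)/‖a‖² is
  -- the same constant for every nonzero a.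
  have hsymm : ∀ a b, (c a : ℂ) * inner ℂ b b = c b * inner ℂ a a := by
    intro a b
    rw [← (hc a b b).2, ← (hc b a a).2, ← integral_inv_eq_self]
    refine integral_congr_ae (.of_forall fun x => ?_)
    simp [voice_inv, mul_comm]
  have hg₀0 : (inner ℂ g₀ g₀ : ℂ) ≠ 0 := inner_self_ne_zero.2 hg₀
  set k : ℂ := c g₀ / inner ℂ g₀ g₀
  have hk : ∀ a f h, ∫ x, starRingEnd ℂ (voice π a f x) * voice π a h x ∂μ =
      k * inner ℂ f h * inner ℂ a a := by
    intro a f h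
    have h1 : (c a : ℂ) = k * inner ℂ a a := by
      simp only [k]
      rw [div_mul_eq_mul_div, ← hsymm, mul_div_cancel_right₀ _ hg₀0]
    rw [(hc a f h).2, h1]
    ring
  clear_value k
  refine ⟨k, ?_, fun a f => ⟨hmem a f, fun b h => ?_⟩⟩
  · intro hk0
    have h1 := hk g₀ g₀ g₀
    rw [hk0, zero_mul, zero_mul] at h1
    have h2 : ∫ x, ‖voice π g₀ g₀ x‖ ^ 2 ∂μ = 0 := by
      rw [← Complex.ofReal_inj, ← integral_complex_ofReal, Complex.ofReal_zero, ← h1]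
      refine integral_congr_ae (.of_forall fun x => ?_)
      simp [Complex.conj_mul']
    -- A zero integral would make the continuous function V_{g₀} g₀ vanish identically, yet its
    -- value at 1 is ‖g₀‖².
    rw [integral_eq_zero_iff_of_nonneg (fun x => by positivity)
      ((hmem g₀ g₀).integrable_norm_pow two_ne_zero)] at h2
    have h3 := (Continuous.ae_eq_iff_eq μ ((hπ.continuous_voice g₀ g₀).norm.pow 2)
      continuous_zero).1 h2
    have h4 := congrFun h3 1
    simp [voice_one, hg₀] at h4
  · have hint : ∀ a b f h, Integrable (fun x => starRingEnd ℂ (voice π a f x) * voice π b h x) μ :=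
      fun a b f h => (hmem a f).star.integrable_mul (hmem b h)
    set B : H → H → ℂ := fun a b => ∫ x, starRingEnd ℂ (voice π a f x) * voice π b h x ∂μ
    -- Polarization in the analyzing vector: the diagonal values at z = 1 and z = i determine B a b.
    have hadd : ∀ a b (z : ℂ), B (a + z • b) (a + z • b) =
        B a a + starRingEnd ℂ z * B a b + z * B b a + z * starRingEnd ℂ z * B b b := by
      intro a b z
      simp only [B]
      have e1 := integral_add (hint a a f h) ((hint a b f h).const_mul (starRingEnd ℂ z))
      have e2 := integral_add ((hint a a f h).add ((hint a b f h).const_mul (starRingEnd ℂ z)))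
        ((hint b a f h).const_mul z)
      have e3 := integral_add (((hint a a f h).add ((hint a b f h).const_mul (starRingEnd ℂ z))).add
        ((hint b a f h).const_mul z)) ((hint b b f h).const_mul (z * starRingEnd ℂ z))
      simp only [Pi.add_apply] at e2 e3
      rw [← integral_const_mul, ← integral_const_mul, ← integral_const_mul, ← e1, ← e2, ← e3]
      refine integral_congr_ae (.of_forall fun x => ?_)
      simp only [voice, map_add, map_smul, inner_add_left, inner_smul_left, map_mul,
        Complex.conj_conj]
      ring
    have hdiag : ∀ a, B a a = k * inner ℂ f h * inner ℂ a a := fun a => hk a f h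
    have e1 := hadd a b 1
    have e2 := hadd a b Complex.I
    rw [hdiag, hdiag, hdiag] at e1 e2
    simp only [inner_add_left, inner_add_right, inner_smul_left, inner_smul_right, map_one,
      Complex.conj_I, one_smul] at e1 e2
    change B a b = _
    have hI : Complex.I * Complex.I = -1 := Complex.I_mul_I
    have e3 : 2 * B a b = 2 * (k * inner ℂ f h * inner ℂ b a) := by
      linear_combination (-1) * e1 - Complex.I * e2 +
        (B a b - k * inner ℂ f h * inner ℂ b a + k * inner ℂ f h * inner ℂ a b - B b a) * hI
    exact mul_left_cancel₀ two_ne_zero e3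

end Orthogonality

theorem enorm_nnreal_smul (c : ℝ≥0) (z : ℂ) : ‖c • z‖ₑ = c * ‖z‖ₑ := by
  rw [NNReal.smul_def, enorm_smul]
  congr 1
  simp [enorm_eq_nnnorm]

/-! ### Strong measurability without σ-compactness -/

section Measurability

variable {X : Type*} [TopologicalSpace X] [R1Space X] [WeaklyLocallyCompactSpace X]
  [MeasurableSpace X] [BorelSpace X] {μ : Measure X} [μ.Regular]

/-- Functions in `L^p` can be approximated by functions that vanish off a compact set. -/
theorem exists_compact_eLpNorm_sub_le {p : ℝ≥0∞} (hp : p ≠ ∞) {E : Type*} [NormedAddCommGroup E]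
    {f : X → E} (hf : MemLp f p μ) {ε : ℝ≥0∞} (hε : ε ≠ 0) :
    ∃ (K : Set X) (g : X → E), IsCompact K ∧ IsClosed K ∧ (∀ x ∉ K, g x = 0) ∧
      eLpNorm (f - g) p μ ≤ ε := by
  obtain ⟨g, hg, -, K, hK, hKc, hgK⟩ := hf.induction_dense hp
    (fun g => AEStronglyMeasurable g μ ∧ ∃ K : Set X, IsCompact K ∧ IsClosed K ∧ ∀ x ∉ K, g x = 0)
    (fun c t ht htμ ε hε => by
      obtain ⟨η, ηpos, hη⟩ := exists_eLpNorm_indicator_le (μ := μ) hp c hε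
      obtain ⟨s, st, s_compact, s_closed, μs⟩ :=
        ht.exists_isCompact_isClosed_sdiff_lt htμ.ne (ENNReal.coe_pos.2 ηpos).ne'
      refine ⟨s.indicator fun _ => c, ?_, aestronglyMeasurable_const.indicator
        s_closed.measurableSet, s, s_compact, s_closed, fun x hx => indicator_of_notMem hx _⟩
      rw [← eLpNorm_neg, neg_sub, ← indicator_sdiff st]
      exact hη _ μs.le)
    (fun f g hf hg => by
      obtain ⟨hf, K, hK, hKc, hfK⟩ := hf
      obtain ⟨hg, L, hL, hLc, hgL⟩ := hg
      refine ⟨hf.add hg, K ∪ L, hK.union hL, hKc.union hLc, fun x hx => ?_⟩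
      rw [mem_union, not_or] at hx
      rw [Pi.add_apply, hfK x hx.1, hgL x hx.2, add_zero])
    (fun f hf => hf.1) hε
  exact ⟨K, g, hK, hKc, hgK, hg⟩

/-- A continuous vector-valued function multiplied by an integrable function is strongly
measurable, without any countability assumption on the space. -/
theorem aestronglyMeasurable_smul_of_integrable {E : Type*} [NormedAddCommGroup E]
    [NormedSpace ℂ E] {φ : X → ℂ} (hφ : Continuous φ) (hint : Integrable φ μ) {γ : X → E}
    (hγ : Continuous γ) : AEStronglyMeasurable (fun x => φ x • γ x) μ := by
  have happ : ∀ n : ℕ, ∃ (K : Set X) (g : X → ℂ), IsCompact K ∧ IsClosed K ∧ (∀ x ∉ K, g x = 0) ∧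
      eLpNorm (φ - g) 1 μ ≤ ((n : ℝ≥0∞) + 1)⁻¹ := fun n =>
    exists_compact_eLpNorm_sub_le ENNReal.one_ne_top (memLp_one_iff_integrable.2 hint) (by simp)
  choose K g hK hKc hgK hg using happ
  set T : Set X := ⋃ n, K n
  have hT : MeasurableSet T := .iUnion fun n => (hKc n).measurableSet
  have hzero : ∫⁻ x in Tᶜ, ‖φ x‖ₑ ∂μ = 0 := by
    refine le_antisymm (ge_of_tendsto' (x := Filter.atTop)
      (f := fun n : ℕ => ((n : ℝ≥0∞) + 1)⁻¹) ?_ fun n => ?_)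
      zero_le
    · have := (ENNReal.tendsto_inv_nat_nhds_zero).comp (tendsto_add_atTop_nat 1)
      simpa [Function.comp_def] using this
    · refine le_trans ?_ (hg n)
      rw [eLpNorm_one_eq_lintegral_enorm]
      refine le_trans (le_of_eq (setLIntegral_congr_fun hT.compl fun x hx => ?_))
        (setLIntegral_le_lintegral Tᶜ _)
      have : g n x = 0 := hgK n x fun h => hx (mem_iUnion.2 ⟨n, h⟩)
      simp [this]
  have hTc : AEStronglyMeasurable (fun x => φ x • γ x) (μ.restrict Tᶜ) := by
    rw [lintegral_eq_zero_iff hφ.enorm.measurable] at hzero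
    refine (aestronglyMeasurable_const (b := (0 : E))).congr ?_
    filter_upwards [hzero] with x hx
    rw [show φ x = 0 by simpa using hx, zero_smul]
  have hTm : AEStronglyMeasurable (fun x => φ x • γ x) (μ.restrict T) :=
    AEStronglyMeasurable.iUnion fun n => (hφ.smul hγ).continuousOn.aestronglyMeasurable_of_isCompact
      (hK n) (hKc n).measurableSet
  rw [← Measure.restrict_univ (μ := μ), ← union_compl_self T]
  exact aestronglyMeasurable_union_iff.2 ⟨hTm, hTc⟩

end Measurability

/-! ### Translations in weighted L¹ -/

section Translation

variable {G : Type*} [Group G] [TopologicalSpace G] [IsTopologicalGroup G]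
  [LocallyCompactSpace G] [T2Space G] [MeasurableSpace G] [BorelSpace G]
  {μ : Measure G} [μ.IsHaarMeasure] [μ.Regular] {m : G → ℝ≥0} {F : G → ℂ}

theorem memWLp_one_iff (hm : Measurable m) (hF : Continuous F) :
    MemWLp μ m 1 F ↔ ∫⁻ x, m x * ‖F x‖ₑ ∂μ < ∞ := by
  rw [MemWLp, MemLp, eLpNorm_one_eq_lintegral_enorm]
  simp only [enorm_nnreal_smul]
  refine and_iff_right ?_
  exact (hm.smul hF.measurable).aestronglyMeasurable

theorem memLp_weight_translate (hm : IsSubmulWeight m) (hF : Continuous F) (hFm : MemWLp μ m 1 F)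
    (y : G) : MemLp (fun x => m (y * x) • F x) 1 μ := by
  refine (MemLp.const_smul hFm (m y : ℝ)).of_le_enorm ?_ (.of_forall fun x => ?_)
  · exact (((hm.continuous.comp (continuous_const_mul y)).measurable).smul
      hF.measurable).aestronglyMeasurable
  · change _ ≤ ‖m y • m x • F x‖ₑ
    rw [enorm_nnreal_smul, enorm_nnreal_smul, enorm_nnreal_smul, ← mul_assoc]
    gcongr
    exact_mod_cast hm.submul y x

/-- On a large compact set, m(yx) tends to m(y₀x) uniformly; off it, the difference of the weights
is at most a constant times m(x), and the tail of mF is small in L¹. -/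
theorem continuous_toLp_weight_translate (hm : IsSubmulWeight m) (hone : ∀ x, 1 ≤ m x)
    (hF : Continuous F) (hFm : MemWLp μ m 1 F) :
    Continuous fun y => (memLp_weight_translate (μ := μ) hm hF hFm y).toLp := by
  rw [continuous_iff_continuousAt]
  intro y₀
  rw [ContinuousAt, EMetric.tendsto_nhds]
  intro ε hε
  set I := ∫⁻ x, m x * ‖F x‖ₑ ∂μ
  have hI : I < ∞ := (memWLp_one_iff hm.continuous.measurable hF).1 hFm
  -- This bounds m(y) + m(y₀) as soon as m(y) < m(y₀) + 1.
  set M : ℝ≥0 := 2 * m y₀ + 1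
  obtain ⟨η, hη, hηε⟩ := ENNReal.exists_nnreal_pos_mul_lt (a := I + M) (by simp [hI.ne]) hε.ne'
  obtain ⟨K, g, hK, -, hgK, hg⟩ := exists_compact_eLpNorm_sub_le ENNReal.one_ne_top hFm
    (ε := η) (by simpa using hη.ne')
  have hev1 : ∀ᶠ y in 𝓝 y₀, m y < m y₀ + 1 :=
    hm.continuous.continuousAt.eventually_lt_const (by simp)
  have hev2 : ∀ᶠ y in 𝓝 y₀, ∀ x ∈ K, ‖(m (y * x) : ℝ) - m (y₀ * x)‖ₑ < η := by
    refine IsCompact.eventually_forall_of_forall_eventually hK fun x hx => ?_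
    have hcont : Continuous fun z : G × G => ‖(m (z.1 * z.2) : ℝ) - m (y₀ * z.2)‖ₑ := by
      have := hm.continuous
      fun_prop
    exact hcont.continuousAt.eventually_lt_const (by simpa using hη)
  filter_upwards [hev1, hev2] with y h1 h2
  rw [Lp.edist_toLp_toLp, eLpNorm_one_eq_lintegral_enorm]
  refine lt_of_le_of_lt ?_ hηε
  have hpt : ∀ x, ‖((fun x => m (y * x) • F x) - fun x => m (y₀ * x) • F x) x‖ₑ ≤
      η * (m x * ‖F x‖ₑ) + M * ‖((fun x => m x • F x) - g) x‖ₑ := by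
    intro x
    have e1 : ‖((fun x => m (y * x) • F x) - fun x => m (y₀ * x) • F x) x‖ₑ =
        ‖(m (y * x) : ℝ) - m (y₀ * x)‖ₑ * ‖F x‖ₑ := by
      rw [Pi.sub_apply, NNReal.smul_def, NNReal.smul_def, ← sub_smul, enorm_smul]
    rw [e1]
    by_cases hx : x ∈ K
    · refine le_trans ?_ le_self_add
      gcongr
      · exact (h2 x hx).le
      · exact le_mul_of_one_le_left zero_le (by exact_mod_cast hone x)
    · refine le_trans ?_ le_add_self
      rw [Pi.sub_apply, hgK x hx, sub_zero, enorm_nnreal_smul,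
        ← mul_assoc]
      gcongr
      have e2 : ‖(m (y * x) : ℝ) - m (y₀ * x)‖ ≤ (M * m x : ℝ≥0) := by
        have k1 : (m (y * x) : ℝ) ≤ m y * m x := by exact_mod_cast hm.submul y x
        have k2 : (m (y₀ * x) : ℝ) ≤ m y₀ * m x := by exact_mod_cast hm.submul y₀ x
        have k3 : (m y : ℝ) ≤ m y₀ + 1 := by exact_mod_cast h1.le
        have k4 : (m y : ℝ) * m x ≤ (m y₀ + 1) * m x := by gcongr
        have k5 : (0 : ℝ) ≤ m (y * x) := NNReal.coe_nonneg _
        have k6 : (0 : ℝ) ≤ m (y₀ * x) := NNReal.coe_nonneg _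
        have k7 : (0 : ℝ) ≤ m x := NNReal.coe_nonneg _
        have k8 : (0 : ℝ) ≤ m y₀ * m x := by positivity
        rw [Real.norm_eq_abs, abs_le]
        push_cast [M]
        constructor <;> nlinarith
      rw [← ENNReal.coe_mul, enorm_eq_nnnorm, ENNReal.coe_le_coe]
      exact e2
  calc _ ≤ ∫⁻ x, (η * (m x * ‖F x‖ₑ) + M * ‖((fun x => m x • F x) - g) x‖ₑ) ∂μ :=
        lintegral_mono hpt
    _ = η * I + M * ∫⁻ x, ‖((fun x => m x • F x) - g) x‖ₑ ∂μ := by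
        have hmeas : Measurable fun x => (m x : ℝ≥0∞) * ‖F x‖ₑ :=
          (measurable_coe_nnreal_ennreal.comp hm.continuous.measurable).mul hF.enorm.measurable
        rw [lintegral_add_left (hmeas.const_mul _), lintegral_const_mul _ hmeas,
          lintegral_const_mul' _ _ (by simp)]
    _ ≤ η * I + M * η := by
        gcongr
        rwa [← eLpNorm_one_eq_lintegral_enorm]
    _ = η * (I + M) := by ring

theorem memWLp_translate (hm : IsSubmulWeight m) (hF : Continuous F) (hFm : MemWLp μ m 1 F)
    (y : G) : MemWLp μ m 1 fun x => F (y⁻¹ * x) := by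
  have := (memLp_weight_translate hm hF hFm y).comp_measurePreserving
    (measurePreserving_mul_left μ y⁻¹)
  simpa [MemWLp, Function.comp_def] using this

/-- The function m(x)F(y⁻¹x) is the left translate by y of x ↦ m(yx)F(x), which already varies
continuously in L¹; translation is jointly continuous there. -/
theorem continuous_toLp_translate (hm : IsSubmulWeight m) (hone : ∀ x, 1 ≤ m x)
    (hF : Continuous F) (hFm : MemWLp μ m 1 F) :
    Continuous fun y => MemLp.toLp _ (memWLp_translate (μ := μ) hm hF hFm y) := by
  let L : C(G, C(G, G)) := (ContinuousMap.mk (fun z : G × G => z.1⁻¹ * z.2) (by fun_prop)).curry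
  have h1 := (continuous_toLp_weight_translate hm hone hF hFm).compMeasurePreservingLp
    L.continuous (fun y => measurePreserving_mul_left μ y⁻¹) ENNReal.one_ne_top
  refine h1.congr fun y => ?_
  refine (Lp.toLp_compMeasurePreserving _ _).trans ?_
  congr 1
  ext x
  simp [L]

theorem lintegral_translate_le (hm : IsSubmulWeight m) (y : G) :
    ∫⁻ x, m x * ‖F (y⁻¹ * x)‖ₑ ∂μ ≤ m y * ∫⁻ x, m x * ‖F x‖ₑ ∂μ := by
  rw [← lintegral_mul_left_eq_self _ y, ← lintegral_const_mul' _ _ (by simp)]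
  refine lintegral_mono fun x => ?_
  rw [inv_mul_cancel_left, ← mul_assoc]
  gcongr
  rw [← ENNReal.coe_mul, ENNReal.coe_le_coe]
  exact hm.submul y x

end Translation

/-! ### The space H¹_m and the reproducing formula -/

section Reproducing

variable {G : Type*} [Group G] [TopologicalSpace G] [IsTopologicalGroup G]
  [LocallyCompactSpace G] [T2Space G] [MeasurableSpace G] [BorelSpace G]
  {μ : Measure G} [μ.IsHaarMeasure] [μ.Regular] {m : G → ℝ≥0}
  {H : Type*} [NormedAddCommGroup H] [InnerProductSpace ℂ H] [CompleteSpace H]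
  {π : G →* (H ≃ₗᵢ[ℂ] H)}

variable (μ π m) in
/-- The space `H¹_m`, realized as the graph of `h ↦ m V_a h` in `H × L¹`. -/
def l1Graph (a : H) : Submodule ℂ (H × Lp ℂ 1 μ) where
  carrier := {e | e.2 =ᵐ[μ] fun x => m x • voice π a e.1 x}
  zero_mem' := by
    change _ =ᵐ[μ] _
    filter_upwards [Lp.coeFn_zero ℂ 1 μ] with x hx
    rw [Prod.snd_zero, hx]
    simp [voice]
  add_mem' {a b} ha hb := by
    change _ =ᵐ[μ] _ at ha hb ⊢
    filter_upwards [Lp.coeFn_add a.2 b.2, ha, hb] with x hx h1 h2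
    rw [Prod.snd_add, hx, Pi.add_apply, h1, h2]
    simp [voice]
  smul_mem' c a ha := by
    change _ =ᵐ[μ] _ at ha ⊢
    filter_upwards [Lp.coeFn_smul c a.2, ha] with x hx h1
    rw [Prod.smul_snd, hx, Pi.smul_apply, h1]
    simp only [voice, Prod.smul_fst, inner_smul_right, NNReal.smul_def, smul_eq_mul,
      Complex.real_smul]
    ring

theorem isClosed_l1Graph (a : H) : IsClosed (l1Graph μ m π a : Set (H × Lp ℂ 1 μ)) :=
  isClosed_graph_Lp (μ := μ) (p := 1) (T := fun f x => m x • voice π a f x) fun x => by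
    unfold voice
    fun_prop

/-- Completeness makes Bochner integrals with values in the graph meaningful. -/
instance (a : H) : CompleteSpace (l1Graph μ m π a) := (isClosed_l1Graph a).completeSpace_coe

theorem memWLp_of_mem_l1Graph {a : H} (e : l1Graph μ m π a) :
    MemWLp μ m 1 (voice π a (e : H × Lp ℂ 1 μ).1) :=
  (memLp_congr_ae e.2).1 (Lp.memLp _)

/-- The element of the graph over a vector of `H¹_m`. -/
noncomputable def l1GraphMk {a h : H} (hh : MemWLp μ m 1 (voice π a h)) : l1Graph μ m π a :=
  ⟨(h, MemLp.toLp _ hh), MemLp.coeFn_toLp hh⟩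

theorem l1Graph_ext {a : H} {e e' : l1Graph μ m π a}
    (h : (e : H × Lp ℂ 1 μ).1 = (e' : H × Lp ℂ 1 μ).1) : e = e' := by
  refine Subtype.ext (Prod.ext h (Lp.ext ?_))
  filter_upwards [e.2, e'.2] with x h1 h2
  rw [h1, h2, h]

theorem memWLp_voice_map (hm : IsSubmulWeight m) (hπ : IsIrreducibleUnitaryRep π) {a b : H}
    (hb : MemWLp μ m 1 (voice π a b)) (y : G) : MemWLp μ m 1 (voice π a (π y b)) := by
  have := memWLp_translate hm (hπ.continuous_voice a b) hb y
  simpa only [← voice_map] using this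

/-- The orbit of a vector of `H¹_m`. -/
noncomputable def l1Orbit (hm : IsSubmulWeight m) (hπ : IsIrreducibleUnitaryRep π) {a b : H}
    (hb : MemWLp μ m 1 (voice π a b)) (y : G) : l1Graph μ m π a :=
  l1GraphMk (memWLp_voice_map hm hπ hb y)

variable {hm : IsSubmulWeight m} {hπ : IsIrreducibleUnitaryRep π}

theorem continuous_l1Orbit (hone : ∀ x, 1 ≤ m x) {a b : H} (hb : MemWLp μ m 1 (voice π a b)) :
    Continuous (l1Orbit hm hπ hb) := by
  refine Continuous.subtype_mk ((hπ.strongly_continuous b).prodMk ?_) _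
  refine (continuous_toLp_translate hm hone (hπ.continuous_voice a b) hb).congr fun y => ?_
  congr 1
  ext x
  rw [voice_map]

theorem norm_toLp_voice {a h : H} (hh : MemWLp μ m 1 (voice π a h)) :
    ‖MemLp.toLp _ hh‖ₑ = ∫⁻ x, m x * ‖voice π a h x‖ₑ ∂μ := by
  refine (Lp.enorm_toLp _).trans ?_
  rw [eLpNorm_one_eq_lintegral_enorm]
  simp only [enorm_nnreal_smul]

theorem enorm_l1Orbit_le (hone : ∀ x, 1 ≤ m x) {a b : H} (hb : MemWLp μ m 1 (voice π a b)) (y : G) :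
    ‖l1Orbit hm hπ hb y‖ₑ ≤ m y * (‖b‖ₑ + ∫⁻ x, m x * ‖voice π a b x‖ₑ ∂μ) := by
  have h1 : ‖l1Orbit hm hπ hb y‖ₑ = max ‖π y b‖ₑ ‖MemLp.toLp _ (memWLp_voice_map hm hπ hb y)‖ₑ := rfl
  rw [h1, norm_toLp_voice, mul_add]
  have h2 : ‖π y b‖ₑ = ‖b‖ₑ := by simp [enorm_eq_nnnorm]
  refine max_le ?_ ?_
  · rw [h2]
    refine le_trans ?_ le_self_add
    exact le_mul_of_one_le_left zero_le (ENNReal.one_le_coe_iff.2 (hone y))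
  · refine le_trans ?_ le_add_self
    have := lintegral_translate_le (μ := μ) (F := voice π a b) hm y
    simpa only [← voice_map] using this

/-- The orbit grows at most like m(y), which is exactly what the weight on φ absorbs. -/
theorem integrable_smul_l1Orbit (hone : ∀ x, 1 ≤ m x) {a b : H} (hb : MemWLp μ m 1 (voice π a b))
    {φ : G → ℂ} (hφ : Continuous φ) (hφm : MemWLp μ m 1 φ) :
    Integrable (fun y => φ y • l1Orbit hm hπ hb y) μ := by
  have hφ1 := (memWLp_one_iff hm.continuous.measurable hφ).1 hφm
  have hφi : Integrable φ μ := by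
    refine ⟨hφ.aestronglyMeasurable, lt_of_le_of_lt (lintegral_mono fun x => ?_) hφ1⟩
    exact le_mul_of_one_le_left zero_le (ENNReal.one_le_coe_iff.2 (hone x))
  refine ⟨aestronglyMeasurable_smul_of_integrable hφ hφi (continuous_l1Orbit hone hb), ?_⟩
  have hfin := (memWLp_one_iff hm.continuous.measurable (hπ.continuous_voice a b)).1 hb
  calc _ ≤ ∫⁻ y, (m y * ‖φ y‖ₑ) * (‖b‖ₑ + ∫⁻ x, m x * ‖voice π a b x‖ₑ ∂μ) ∂μ := by
        refine lintegral_mono fun y => ?_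
        rw [enorm_smul]
        refine (mul_le_mul_right (enorm_l1Orbit_le hone hb y) _).trans (le_of_eq ?_)
        ring
    _ < ∞ := by
        rw [lintegral_mul_const' _ _ (by simp [hfin.ne])]
        exact ENNReal.mul_lt_top hφ1 (by simp [hfin])

variable {c : ℂ}

/-- The reproducing formula, as a Bochner integral in `H¹_m`. -/
theorem integral_smul_l1Orbit_fst (hone : ∀ x, 1 ≤ m x)
    (hc : ∀ a f b h : H, ∫ x, starRingEnd ℂ (voice π a f x) * voice π b h x ∂μ =
      c * inner ℂ f h * inner ℂ b a)
    {a b : H} (hb : MemWLp μ m 1 (voice π a b)) {k h : H} (hh : MemWLp μ m 1 (voice π k h)) :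
    ((∫ y, voice π k h y • l1Orbit hm hπ hb y ∂μ : l1Graph μ m π a) : H × Lp ℂ 1 μ).1 =
      (c * inner ℂ k b) • h := by
  have hint := integrable_smul_l1Orbit (hm := hm) (hπ := hπ) hone hb (hπ.continuous_voice k h) hh
  let P : l1Graph μ m π a →L[ℂ] H := (ContinuousLinearMap.fst ℂ H (Lp ℂ 1 μ)).comp
    (l1Graph μ m π a).subtypeL
  change P _ = _
  rw [← P.integral_comp_comm hint]
  -- Tested against s, the vector identity becomes the orthogonality relation for V_b s and V_k h.
  refine ext_inner_left ℂ fun s => ?_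
  have hint' := P.integrable_comp hint
  rw [← integral_inner hint']
  have h1 : ∀ y, inner ℂ s (P (voice π k h y • l1Orbit hm hπ hb y)) =
      starRingEnd ℂ (voice π b s y) * voice π k h y := by
    intro y
    rw [map_smul, inner_smul_right, mul_comm, voice, voice, inner_conj_symm]
    rfl
  simp only [h1]
  rw [hc, inner_smul_right]
  ring

/-- Independence of the analyzing vector: the reproducing formula exhibits a nonzero multiple of h
as an integral inside the graph over a, so h belongs to that space. -/
theorem memWLp_voice_of_memWLp (hm : IsSubmulWeight m) (hπ : IsIrreducibleUnitaryRep π)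
    (hone : ∀ x, 1 ≤ m x) (hc0 : c ≠ 0)
    (hc : ∀ a f b h : H, ∫ x, starRingEnd ℂ (voice π a f x) * voice π b h x ∂μ =
      c * inner ℂ f h * inner ℂ b a)
    {a b : H} (hb : MemWLp μ m 1 (voice π a b)) (hb0 : b ≠ 0) {k h : H}
    (hh : MemWLp μ m 1 (voice π k h)) (hk : k ≠ 0) : MemWLp μ m 1 (voice π a h) := by
  -- Since k and b may be orthogonal, b is replaced by a translate that is not orthogonal to k.
  obtain ⟨x, hx⟩ := hπ.exists_inner_ne_zero hb0 hk
  have hbx := memWLp_voice_map hm hπ hb x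
  have h1 := memWLp_of_mem_l1Graph (∫ y, voice π k h y • l1Orbit hm hπ hbx y ∂μ : l1Graph μ m π a)
  rw [integral_smul_l1Orbit_fst hone hc hbx hh] at h1
  have hz : c * inner ℂ k (π x b) ≠ 0 := by
    refine mul_ne_zero hc0 fun h0 => hx ?_
    rw [← inner_conj_symm, h0, map_zero]
  have h2 := ((H1 μ π m a).smul_mem_iff hz).1 h1
  exact h2

/-- Continuous functionals on `H¹_m` are given by integration against the voice transform. -/
theorem integral_voice_mul_functional (hone : ∀ x, 1 ≤ m x)
    (hc : ∀ a f b h : H, ∫ x, starRingEnd ℂ (voice π a f x) * voice π b h x ∂μ =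
      c * inner ℂ f h * inner ℂ b a)
    {a b : H} (hb : MemWLp μ m 1 (voice π a b)) {k h : H} (hh : MemWLp μ m 1 (voice π k h))
    (hah : MemWLp μ m 1 (voice π a h)) (Λ : l1Graph μ m π a →L[ℂ] ℂ) :
    ∫ y, voice π k h y * Λ (l1Orbit hm hπ hb y) ∂μ = c * inner ℂ k b * Λ (l1GraphMk hah) := by
  have hint := integrable_smul_l1Orbit (hm := hm) (hπ := hπ) hone hb (hπ.continuous_voice k h) hh
  have h1 : ∫ y, voice π k h y • l1Orbit hm hπ hb y ∂μ = (c * inner ℂ k b) • l1GraphMk hah :=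
    l1Graph_ext (integral_smul_l1Orbit_fst hone hc hb hh)
  rw [← smul_eq_mul (c * _), ← map_smul, ← h1, ← Λ.integral_comp_comm hint]
  simp

end Reproducing

/-! ### Discretization, convolution and inversion -/

section Discretization

variable {G : Type*} [Group G] [TopologicalSpace G] [IsTopologicalGroup G]
  [LocallyCompactSpace G] [T2Space G] [MeasurableSpace G] [BorelSpace G]
  {μ : Measure G} [μ.IsHaarMeasure] [μ.Regular] {m : G → ℝ≥0} {r : ℝ} {F : G → ℂ}

/-- Take a maximal family of disjoint translates of U: if y were not covered, yU could be added to
it. -/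
theorem exists_maximal_disjoint_translates {U : Set G} (hU : U.Nonempty) :
    ∃ X : Set G, X.PairwiseDisjoint (fun x => x • U) ∧ ∀ y, ∃ x ∈ X, y ∈ x • (U * U⁻¹) := by
  obtain ⟨X, hX⟩ := zorn_subset {X : Set G | X.PairwiseDisjoint (fun x => x • U)}
    (fun c hc hchain => ⟨⋃₀ c, pairwiseDisjoint_sUnion hchain.directedOn |>.2 fun s hs => hc hs,
      fun s hs => subset_sUnion_of_mem hs⟩)
  refine ⟨X, hX.prop, fun y => ?_⟩
  by_contra! hy
  have hins : insert y X ∈ {X : Set G | X.PairwiseDisjoint (fun x => x • U)} := by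
    refine hX.prop.insert fun x hx _ => ?_
    rw [Set.disjoint_left]
    rintro _ ⟨u, hu, rfl⟩ ⟨u', hu', h⟩
    refine hy x hx ⟨u' * u⁻¹, ⟨u', hu', u⁻¹, inv_mem_inv.2 hu, rfl⟩, ?_⟩
    simp only [smul_eq_mul] at h ⊢
    rw [← mul_assoc, h, mul_inv_cancel_right]
  have hyX : y ∈ X := hX.le_of_ge hins (subset_insert y X) (mem_insert y X)
  obtain ⟨u, hu⟩ := hU
  exact hy y hyX ⟨u * u⁻¹, ⟨u, hu, u⁻¹, inv_mem_inv.2 hu, rfl⟩, by simp⟩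

/-- Sampling the local suprema along a separated set. -/
theorem exists_tsum_le_ampInt (hm : IsSubmulWeight m) (hr : 0 < r) {U T : Set G} (hUo : IsOpen U)
    (hU1 : (1 : G) ∈ U) (hUc : IsCompact (closure U)) :
    ∃ C : ℝ≥0, ∀ (F : G → ℂ) (X : Set G), X.PairwiseDisjoint (fun x => x • U) →
      ∑' x : X, (m x * localSup μ F ((x : G) • T)) ^ r ≤ C * ampInt μ m r F (U⁻¹ * T) := by
  obtain ⟨D, hD⟩ := (hUc.inv).bddAbove_image hm.continuous.continuousOn
  have hU0 : μ U ≠ 0 := (hUo.measure_pos μ ⟨1, hU1⟩).ne'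
  have hUt : μ U ≠ ∞ := ((measure_mono subset_closure).trans_lt hUc.measure_lt_top).ne
  refine ⟨(D ^ r) * (μ U)⁻¹.toNNReal, fun F X hX => ?_⟩
  rw [ENNReal.coe_mul, ENNReal.coe_toNNReal (ENNReal.inv_ne_top.2 hU0),
    ENNReal.coe_rpow_of_nonneg _ hr.le]
  -- Each sample is averaged over xU: for y = xu the enlarged window y(U⁻¹T) contains xT, and m(x) ≤
  -- D m(y).
  have hpt : ∀ x : G, (m x * localSup μ F (x • T)) ^ r * μ U ≤
      D ^ r * ∫⁻ y in x • U, (m y * localSup μ F (y • (U⁻¹ * T))) ^ r ∂μ := by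
    intro x
    rw [← measure_smul μ x U, ← setLIntegral_const, ← lintegral_const_mul' _ _ (by simp [hr.le])]
    refine setLIntegral_mono' (hUo.smul x).measurableSet ?_
    rintro _ ⟨u, hu, rfl⟩
    rw [← ENNReal.mul_rpow_of_nonneg _ _ hr.le, ← mul_assoc]
    refine ENNReal.rpow_le_rpow ?_ hr.le
    refine mul_le_mul' ?_ (localSup_mono ?_)
    · rw [← ENNReal.coe_mul, ENNReal.coe_le_coe]
      calc m x = m ((x • u) * u⁻¹) := by simp
        _ ≤ m (x • u) * m u⁻¹ := hm.submul _ _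
        _ ≤ m (x • u) * D := by
          gcongr
          exact hD ⟨u⁻¹, inv_mem_inv.2 (subset_closure hu), rfl⟩
        _ = _ := mul_comm _ _
    · rintro _ ⟨t, ht, rfl⟩
      exact ⟨u⁻¹ * t, ⟨u⁻¹, inv_mem_inv.2 hu, t, ht, rfl⟩, by simp⟩
  rw [ENNReal.tsum_eq_iSup_sum]
  refine iSup_le fun s => ?_
  rw [mul_right_comm, ← div_eq_mul_inv, ENNReal.le_div_iff_mul_le (.inl hU0) (.inl hUt),
    Finset.sum_mul]
  refine (Finset.sum_le_sum fun (a : X) _ => hpt a).trans ?_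
  rw [← Finset.mul_sum, ← lintegral_biUnion_finset]
  · gcongr
    exact setLIntegral_le_lintegral _ _
  · exact fun a _ b _ hab => hX a.2 b.2 (Subtype.coe_injective.ne hab)
  · exact fun a _ => (hUo.smul _).measurableSet

theorem tsum_rpow_le {ι : Type*} (hr : 0 < r) (hr1 : r ≤ 1) (f : ι → ℝ≥0∞) :
    (∑' i, f i) ^ r ≤ ∑' i, f i ^ r := by
  rw [← ENNReal.le_rpow_inv_iff hr, ENNReal.tsum_eq_iSup_sum]
  refine iSup_le fun s => (ENNReal.le_rpow_inv_iff hr).2 ?_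
  exact (finset_sum_rpow_le hr hr1 s f).trans (ENNReal.sum_le_tsum s)

/-- The index set may be uncountable. If the sum is finite, only countably many c i are nonzero, and
f vanishes on the remaining pieces. -/
theorem lintegral_le_tsum {ι : Type*} {x : ι → G} {T : Set G} (hT : IsOpen T) (hT1 : T.Nonempty)
    (hcov : ∀ y, ∃ i, y ∈ x i • T) {f : G → ℝ≥0∞} {c : ι → ℝ≥0∞}
    (hf : ∀ i, ∀ y ∈ x i • T, f y ≤ c i) : ∫⁻ y, f y ∂μ ≤ μ T * ∑' i, c i := by
  by_cases hc : ∑' i, c i = ∞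
  · rw [hc, ENNReal.mul_top (hT.measure_pos μ hT1).ne']
    exact le_top
  have hcount : (Function.support c).Countable := Summable.countable_support_ennreal hc
  have := hcount.to_subtype
  set S := ⋃ i : Function.support c, x i • T
  have hS : MeasurableSet S := (isOpen_iUnion fun i => hT.smul _).measurableSet
  calc ∫⁻ y, f y ∂μ ≤ ∫⁻ y, S.indicator f y ∂μ := by
        refine lintegral_mono fun y => ?_
        by_cases hy : y ∈ S
        · rw [indicator_of_mem hy]
        obtain ⟨i, hi⟩ := hcov y
        refine (hf i y hi).trans ?_
        have : c i = 0 := by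
          by_contra h0
          exact hy (mem_iUnion.2 ⟨⟨i, h0⟩, hi⟩)
        rw [this]
        exact zero_le
    _ = ∫⁻ y in S, f y ∂μ := lintegral_indicator hS _
    _ ≤ ∑' i : Function.support c, ∫⁻ y in x i • T, f y ∂μ := lintegral_iUnion_le _ _
    _ ≤ ∑' i : Function.support c, μ T * c i := by
        refine ENNReal.tsum_le_tsum fun i => ?_
        refine (setLIntegral_mono' (hT.smul _).measurableSet (hf i)).trans_eq ?_
        rw [setLIntegral_const, measure_smul, mul_comm]
    _ ≤ ∑' i, μ T * c i := ENNReal.tsum_comp_le_tsum_of_injective Subtype.coe_injective _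
    _ = _ := ENNReal.tsum_mul_left

/-- Finiteness of the sum confines it to a countable support, where monotone convergence applies. -/
theorem lintegral_tsum_const_mul {ι : Type*} {c : ι → ℝ≥0∞} (hc : ∑' i, c i ≠ ∞)
    {f : ι → G → ℝ≥0∞} (hf : ∀ i, Measurable (f i)) :
    ∫⁻ y, ∑' i, c i * f i y ∂μ = ∑' i, c i * ∫⁻ y, f i y ∂μ := by
  have hcount : (Function.support c).Countable := Summable.countable_support_ennreal hc
  have := hcount.to_subtype
  have h : ∀ g : ι → ℝ≥0∞, ∑' i : Function.support c, c i * g i = ∑' i, c i * g i := fun g =>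
    tsum_subtype_eq_of_support_subset (f := fun i => c i * g i) fun i hi =>
      left_ne_zero_of_mul (Function.mem_support.1 hi)
  simp only [← h]
  rw [lintegral_tsum fun i : Function.support c => ((hf i).const_mul _).aemeasurable]
  exact tsum_congr fun i => lintegral_const_mul _ (hf i)

theorem IsINGroup.exists_small_window (hIN : IsINGroup G) : ∃ V U : Set G, IsCompact V ∧
    IsWindow V ∧ (∀ x : G, x • V = (fun q => q * x) '' V) ∧ IsOpen U ∧ (1 : G) ∈ U ∧
    IsCompact (closure U) ∧ U * U⁻¹ ⊆ V := by
  obtain ⟨V, hVc, hV, hVx⟩ := hIN.exists_window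
  obtain ⟨U, hU, hU1, hUV⟩ : ∃ U : Set G, IsOpen U ∧ (1 : G) ∈ U ∧ U * U⁻¹ ⊆ V := by
    have h : (fun z : G × G => z.1 * z.2⁻¹) ⁻¹' V ∈ 𝓝 ((1 : G), (1 : G)) :=
      (show Continuous fun z : G × G => z.1 * z.2⁻¹ by fun_prop).continuousAt.preimage_mem_nhds
        (by simpa using hV.mem_nhds)
    rw [nhds_prod_eq, mem_prod_same_iff] at h
    obtain ⟨t, ht, htV⟩ := h
    obtain ⟨U, hUt, hU, hU1⟩ := mem_nhds_iff.1 ht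
    refine ⟨U, hU, hU1, ?_⟩
    rintro _ ⟨a, ha, b, hb, rfl⟩
    have := htV (show (a, b⁻¹) ∈ t ×ˢ t from ⟨hUt ha, hUt hb⟩)
    simpa using this
  refine ⟨V, U, hVc, hV, hVx, hU, hU1, hVc.closure_of_subset ?_, hUV⟩
  exact fun u hu => hUV ⟨u, hu, 1, by simpa using hU1, by simp⟩

/-- After sampling along a separated set this is the inclusion ℓ^r ⊂ ℓ¹ for r ≤ 1. -/
theorem lintegral_mul_enorm_lt_top [μ.IsMulRightInvariant] (hIN : IsINGroup G)
    (hm : IsSubmulWeight m) (hr : 0 < r) (hr1 : r ≤ 1) {Q : Set G} (hQ : IsWindow Q)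
    (hF : Continuous F) (h : ampInt μ m r F Q < ∞) : ∫⁻ x, m x * ‖F x‖ₑ ∂μ < ∞ := by
  obtain ⟨V, U, hVc, hV, hVx, hU, hU1, hUc, hUV⟩ := hIN.exists_small_window
  have hT : IsOpen (U * U⁻¹) := hU.mul_right
  have hT1 : (1 : G) ∈ U * U⁻¹ := ⟨1, hU1, 1, by simpa using hU1, by simp⟩
  obtain ⟨X, hX, hcov⟩ := exists_maximal_disjoint_translates ⟨1, hU1⟩
  obtain ⟨C, hC⟩ := exists_tsum_le_ampInt (μ := μ) (T := U * U⁻¹) hm hr hU hU1 hUc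
  have hE : IsCompact (closure (U⁻¹ * (U * U⁻¹))) :=
    ((hUc.inv).mul hVc).closure_of_subset
      (mul_subset_mul (inv_subset_inv.2 subset_closure) hUV)
  obtain ⟨C', hC'⟩ := exists_ampInt_le (μ := μ) hm hr hr1 hE hQ
  obtain ⟨D, hD⟩ := hVc.bddAbove_image hm.continuous.continuousOn
  have hsum : ∑' x : X, m x * localSup μ F ((x : G) • (U * U⁻¹)) ≠ ∞ := by
    intro htop
    have := (tsum_rpow_le hr hr1 fun x : X => m x * localSup μ F ((x : G) • (U * U⁻¹))).trans
      ((hC F X hX).trans (mul_le_mul_right (hC' F fun K _ => hF.aestronglyMeasurable) _))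
    rw [htop, ENNReal.top_rpow_of_pos hr, top_le_iff] at this
    exact absurd this (by finiteness)
  refine (lintegral_le_tsum hT ⟨1, hT1⟩ (x := fun x : X => (x : G)) (fun y => ?_)
    (c := fun x : X => D * (m x * localSup μ F ((x : G) • (U * U⁻¹)))) fun x y hy => ?_).trans_lt ?_
  · obtain ⟨x, hx, hy⟩ := hcov y
    exact ⟨⟨x, hx⟩, hy⟩
  · rw [← mul_assoc]
    refine mul_le_mul' ?_ (enorm_le_localSup hF ((hT.smul _).mem_nhds hy))
    obtain ⟨t, ht, rfl⟩ := hy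
    rw [← ENNReal.coe_mul, ENNReal.coe_le_coe]
    calc m ((x : G) • t) ≤ m x * m t := hm.submul _ _
      _ ≤ m x * D := by
        gcongr
        exact hD ⟨t, hUV ht, rfl⟩
      _ = _ := mul_comm _ _
  · rw [ENNReal.tsum_mul_left]
    have : μ (U * U⁻¹) < ∞ := (measure_mono hUV).trans_lt hVc.measure_lt_top
    finiteness

/-- The amalgam spaces are closed under convolution of continuous functions. -/
theorem ampInt_lt_top_of_le_convolution [μ.IsMulRightInvariant] (hIN : IsINGroup G)
    (hm : IsSubmulWeight m) (hr : 0 < r) (hr1 : r ≤ 1) {Q : Set G} (hQ : IsWindow Q)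
    {F₁ F₂ F : G → ℂ} (hF₁ : Continuous F₁) (hF₂ : Continuous F₂) (hF : Continuous F)
    (h₁ : ampInt μ m r F₁ Q < ∞) (h₂ : ampInt μ m r F₂ Q < ∞) {c : ℝ≥0∞} (hc : c ≠ ∞)
    (h : ∀ x, ‖F x‖ₑ ≤ c * ∫⁻ y, ‖F₁ y‖ₑ * ‖F₂ (y⁻¹ * x)‖ₑ ∂μ) : ampInt μ m r F Q < ∞ := by
  obtain ⟨V, U, hVc, hV, hVx, hU, hU1, hUc, hUV⟩ := hIN.exists_small_window
  set T := U * U⁻¹ with hTdef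
  have hT : IsOpen T := hU.mul_right
  have hT1 : (1 : G) ∈ T := ⟨1, hU1, 1, by simpa using hU1, by simp⟩
  have hTinv : ∀ t ∈ T, t⁻¹ ∈ T := by
    rintro _ ⟨a, ha, b, hb, rfl⟩
    exact ⟨b⁻¹, hb, a⁻¹, by simpa using ha, by simp⟩
  have hμT : μ T ≠ ∞ := ((measure_mono hUV).trans_lt hVc.measure_lt_top).ne
  obtain ⟨X, hX, hcov⟩ := exists_maximal_disjoint_translates ⟨1, hU1⟩
  obtain ⟨C, hC⟩ := exists_tsum_le_ampInt (μ := μ) (T := T) hm hr hU hU1 hUc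
  have hE : IsCompact (closure (U⁻¹ * T)) :=
    ((hUc.inv).mul hVc).closure_of_subset
      (mul_subset_mul (inv_subset_inv.2 subset_closure) hUV)
  obtain ⟨C₁, hC₁⟩ := exists_ampInt_le (μ := μ) hm hr hr1 hE hQ
  -- One factor V absorbs t⁻¹ after it is moved across i⁻¹x, the other absorbs the point of the
  -- window xV; the factor U makes the set open, so that point values are bounded by local suprema.
  set E₂ := V * V * U with hE₂def
  have hE₂o : IsOpen E₂ := hU.mul_left
  have hE₂ : IsCompact (closure E₂) :=
    ((hVc.mul hVc).mul hUc).closure_of_subset (mul_subset_mul_left subset_closure)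
  obtain ⟨C₂, hC₂⟩ := exists_ampInt_le (μ := μ) hm hr hr1 hE₂ hQ
  obtain ⟨C₃, hC₃⟩ := exists_ampInt_le (μ := μ) hm hr hr1 hQ.relCompact hV
  have hsum : ∑' x : X, (m x * localSup μ F₁ ((x : G) • T)) ^ r < ∞ :=
    ((hC F₁ X hX).trans (mul_le_mul_right (hC₁ F₁ fun K _ => hF₁.aestronglyMeasurable) _)).trans_lt
      (by finiteness)
  -- For y = it and a point xv of the window, y⁻¹xv = t⁻¹(i⁻¹x)v lies in (i⁻¹x)VV, by conjugation
  -- invariance of V.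
  have hsup : ∀ x, localSup μ F (x • V) ≤ c * (μ T * ∑' i : X, localSup μ F₁ ((i : G) • T) *
      localSup μ F₂ (((i : G)⁻¹ * x) • E₂)) := by
    intro x
    refine localSup_le_of_forall (hV.measurableSet.const_smul x) ?_
    rintro _ ⟨v, hv, rfl⟩
    refine (h _).trans (mul_le_mul_right (lintegral_le_tsum hT ⟨1, hT1⟩ (x := fun i : X => (i : G))
      (fun y => ?_) fun i y hy => ?_) _)
    · obtain ⟨i, hi, hy⟩ := hcov y
      exact ⟨⟨i, hi⟩, hy⟩
    · refine mul_le_mul' (enorm_le_localSup hF₁ ((hT.smul _).mem_nhds hy))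
        (enorm_le_localSup hF₂ ((hE₂o.smul _).mem_nhds ?_))
      obtain ⟨t, ht, rfl⟩ := hy
      have h1 : t⁻¹ * ((i : G)⁻¹ * x) ∈ ((i : G)⁻¹ * x) • V := by
        rw [hVx]
        exact ⟨t⁻¹, hUV (hTinv t ht), rfl⟩
      obtain ⟨v', hv', hv'x⟩ := h1
      refine ⟨v' * v * 1, ⟨v' * v, ⟨v', hv', v, hv, rfl⟩, 1, hU1, rfl⟩, ?_⟩
      simp only [smul_eq_mul] at hv'x ⊢
      rw [mul_one, ← mul_assoc, hv'x]
      group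
  refine (hC₃ F fun K _ => hF.aestronglyMeasurable).trans_lt
    (ENNReal.mul_lt_top ENNReal.coe_lt_top ?_)
  set a : X → ℝ≥0∞ := fun i => (m i * localSup μ F₁ ((i : G) • T)) ^ r
  set f : X → G → ℝ≥0∞ := fun i x =>
    (m ((i : G)⁻¹ * x) * localSup μ F₂ (((i : G)⁻¹ * x) • E₂)) ^ r
  have hf : ∀ i, Measurable (f i) := fun i =>
    (measurable_ampInt_integrand (μ := μ) (r := r) hm.continuous.measurable
      (fun K _ => hF₂.aestronglyMeasurable) hE₂o.measurableSet hE₂).comp (measurable_const_mul _)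
  have hfint : ∀ i, ∫⁻ x, f i x ∂μ = ampInt μ m r F₂ E₂ := fun i =>
    lintegral_mul_left_eq_self
      (fun x => ((m x : ℝ≥0∞) * localSup μ F₂ (x • E₂)) ^ r) (i : G)⁻¹
  -- With m(x) ≤ m(i) m(i⁻¹x) and the power r taken inside the sum, left invariance makes the
  -- integral of every summand the same multiple of its coefficient.
  calc ampInt μ m r F V ≤ ∫⁻ x, (c * μ T) ^ r * ∑' i, a i * f i x ∂μ := by
        refine lintegral_mono fun x => ?_
        calc (m x * localSup μ F (x • V)) ^ r
            ≤ (c * μ T * ∑' i : X, (m i * localSup μ F₁ ((i : G) • T)) *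
              (m ((i : G)⁻¹ * x) * localSup μ F₂ (((i : G)⁻¹ * x) • E₂))) ^ r := by
              refine ENNReal.rpow_le_rpow ?_ hr.le
              refine (mul_le_mul_right (hsup x) _).trans ?_
              rw [← mul_assoc c, mul_left_comm]
              refine mul_le_mul_right ?_ _
              rw [← ENNReal.tsum_mul_left]
              refine ENNReal.tsum_le_tsum fun i => ?_
              rw [mul_mul_mul_comm]
              refine mul_le_mul_left ?_ _
              rw [← ENNReal.coe_mul, ENNReal.coe_le_coe]
              simpa using hm.submul i ((i : G)⁻¹ * x)
          _ ≤ _ := by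
              rw [ENNReal.mul_rpow_of_nonneg _ _ hr.le]
              refine mul_le_mul_right ((tsum_rpow_le hr hr1 _).trans_eq ?_) _
              exact tsum_congr fun i => ENNReal.mul_rpow_of_nonneg _ _ hr.le
    _ = (c * μ T) ^ r * ∑' i, a i * ampInt μ m r F₂ E₂ := by
        rw [lintegral_const_mul' _ _ (by finiteness), lintegral_tsum_const_mul hsum.ne hf]
        simp only [hfint, a]
    _ < ∞ := by
        rw [ENNReal.tsum_mul_right]
        have := (hC₂ F₂ fun K _ => hF₂.aestronglyMeasurable).trans_lt
          (ENNReal.mul_lt_top ENNReal.coe_lt_top h₂)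
        finiteness

/-- After substituting y⁻¹ for y, the inverted window is Q⁻¹y, which is covered by finitely many aVy
= ayV. These are windows for left translates of F, and such translates are bounded. -/
theorem exists_lintegral_inv_le [μ.IsMulRightInvariant] [μ.IsInvInvariant] (hIN : IsINGroup G)
    (hm : IsSubmulWeight m) (hr : 0 < r) (hr1 : r ≤ 1) {Q : Set G} (hQ : IsWindow Q) :
    ∃ C : ℝ≥0, ∀ F : G → ℂ, Continuous F →
      ∫⁻ y, (m y⁻¹ * localSup μ (fun x => F x⁻¹) (y • Q)) ^ r ∂μ ≤ C * ampInt μ m r F Q := by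
  obtain ⟨V, hVc, hV, hVx⟩ := hIN.exists_window
  obtain ⟨s, hs⟩ := exists_finset_cover (E := Q⁻¹) (by
    rw [← inv_closure]; exact hQ.relCompact.inv) hV.mem_nhds
  obtain ⟨C, hC⟩ := exists_ampInt_le (μ := μ) hm hr hr1 hV.relCompact hQ
  refine ⟨(∑ a ∈ s, (m a⁻¹) ^ r) * C, fun F hF => ?_⟩
  have hcov : ∀ y : G, (y⁻¹ • Q)⁻¹ ⊆ ⋃ a ∈ s, a • y • V := by
    rintro y z ⟨q, hq, hqz⟩
    have hz : z = q⁻¹ * y := by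
      rw [← inv_inj, ← hqz]; simp
    obtain ⟨a, ha, v, hv, hva⟩ := mem_iUnion₂.1 (hs (inv_mem_inv.2 hq))
    refine mem_iUnion₂.2 ⟨a, ha, ?_⟩
    rw [hVx y]
    refine ⟨v * y, ⟨v, hv, rfl⟩, ?_⟩
    simp only [smul_eq_mul] at hva ⊢
    rw [hz, ← hva, mul_assoc]
  calc _ = ∫⁻ y, ((m y : ℝ≥0∞) * localSup μ F (y⁻¹ • Q)⁻¹) ^ r ∂μ := by
        rw [← lintegral_inv_eq_self]
        refine lintegral_congr fun y => ?_
        rw [inv_inv, ← image_inv_eq_inv]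
        congr 2
        exact localSup_comp_measurableEquiv (e := MeasurableEquiv.inv G)
          (Measure.measurePreserving_inv μ) _
    _ ≤ ∫⁻ y, ∑ a ∈ s, ((m y : ℝ≥0∞) * localSup μ (leftTrans a⁻¹ F) (y • V)) ^ r ∂μ := by
        refine lintegral_mono fun y => ?_
        refine le_trans ?_ (finset_sum_rpow_le hr hr1 s _)
        rw [← Finset.mul_sum]
        refine ENNReal.rpow_le_rpow (mul_le_mul_right ?_ _) hr.le
        simp only [localSup_leftTrans, inv_inv]
        exact localSup_le_sum s (hcov y)
    _ = ∑ a ∈ s, ampInt μ m r (leftTrans a⁻¹ F) V := by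
        refine lintegral_finsetSum _ fun a _ => measurable_ampInt_integrand
          hm.continuous.measurable (fun K _ => ?_) hV.measurableSet hV.relCompact
        exact (hF.comp (continuous_const_mul _)).aestronglyMeasurable
    _ ≤ ∑ a ∈ s, (m a⁻¹ : ℝ≥0∞) ^ r * (C * ampInt μ m r F Q) := by
        refine Finset.sum_le_sum fun a _ => (ampInt_leftTrans_le hm hr _ _).trans ?_
        gcongr
        exact hC F fun K _ => hF.aestronglyMeasurable
    _ = _ := by
        rw [← Finset.sum_mul]
        push_cast
        simp only [← ENNReal.coe_rpow_of_nonneg _ hr.le]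
        ring

theorem ampInt_inv_lt_top [μ.IsMulRightInvariant] [μ.IsInvInvariant] (hIN : IsINGroup G)
    (hm : IsSubmulWeight m) (hsymm : ∀ x, m x⁻¹ = m x) (hr : 0 < r) (hr1 : r ≤ 1) {Q : Set G}
    (hQ : IsWindow Q) (hF : Continuous F) (h : ampInt μ m r F Q < ∞) :
    ampInt μ m r (fun x => F x⁻¹) Q < ∞ := by
  obtain ⟨C, hC⟩ := exists_lintegral_inv_le (μ := μ) hIN hm hr hr1 hQ
  have := hC F hF
  simp only [hsymm] at this
  exact this.trans_lt (ENNReal.mul_lt_top ENNReal.coe_lt_top h)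

/-- When |F| is symmetric, the inversion estimate also controls the integral with weight m(y⁻¹), and
the integrand for the maximum is at most the sum of the two. -/
theorem ampInt_bullet_lt_top_iff [μ.IsMulRightInvariant] [μ.IsInvInvariant] (hIN : IsINGroup G)
    (hm : IsSubmulWeight m) (hr : 0 < r) (hr1 : r ≤ 1) {Q : Set G} (hQ : IsWindow Q)
    (hF : Continuous F) (hFinv : ∀ x, ‖F x⁻¹‖ = ‖F x‖) :
    ampInt μ (bullet m) r F Q < ∞ ↔ ampInt μ m r F Q < ∞ := by
  refine ⟨fun h => lt_of_le_of_lt (lintegral_mono fun y => ?_) h, fun h => ?_⟩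
  · refine ENNReal.rpow_le_rpow (mul_le_mul_left ?_ _) hr.le
    exact ENNReal.coe_le_coe.2 (le_max_left _ _)
  obtain ⟨C, hC⟩ := exists_lintegral_inv_le (μ := μ) hIN hm hr hr1 hQ
  have h2 := (hC F hF).trans_lt (ENNReal.mul_lt_top ENNReal.coe_lt_top h)
  simp only [localSup_congr_norm hFinv] at h2
  refine lt_of_le_of_lt ?_ (ENNReal.add_lt_top.2 ⟨h, h2⟩)
  rw [ampInt, ampInt, ← lintegral_add_left (measurable_ampInt_integrand hm.continuous.measurable
    (fun K _ => hF.aestronglyMeasurable) hQ.measurableSet hQ.relCompact)]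
  refine lintegral_mono fun y => ?_
  rcases le_total (m y) (m y⁻¹) with hle | hle
  · simp only [bullet, max_eq_right hle]
    exact le_add_self
  · simp only [bullet, max_eq_left hle]
    exact le_self_add

end Discretization

/-! ### Comparison of weights -/

section Weights

variable {G : Type*} [Group G] [TopologicalSpace G] [IsTopologicalGroup G]
  [LocallyCompactSpace G] [T2Space G] [MeasurableSpace G] [BorelSpace G]
  {μ : Measure G} [μ.IsHaarMeasure] [μ.Regular] {m v : G → ℝ≥0} {r : ℝ} {p : ℝ≥0∞} {F : G → ℂ}
  {Q : Set G}

theorem memAmalgam_iff_of_continuous [μ.IsMulRightInvariant] (hm : Measurable m) (hQ : IsWindow Q)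
    (hp0 : 0 < p) (hp1 : p ≤ 1) (hF : Continuous F) :
    MemAmalgam μ Q m p F ↔ ampInt μ m p.toReal F Q < ∞ :=
  (memAmalgam_iff hm hQ hp0 hp1).trans (and_iff_right (locLinfty_of_continuous hF))

theorem ampInt_lt_top_of_le (hr : 0 < r) {C : ℝ≥0} (h : ∀ x, m x ≤ C * v x)
    (hv : ampInt μ v r F Q < ∞) : ampInt μ m r F Q < ∞ := by
  have h1 : ampInt μ m r F Q ≤ (C : ℝ≥0∞) ^ r * ampInt μ v r F Q := by
    rw [ampInt, ampInt, ← lintegral_const_mul' _ _ (by finiteness)]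
    refine lintegral_mono fun y => ?_
    rw [← ENNReal.mul_rpow_of_nonneg _ _ hr.le, ← mul_assoc]
    refine ENNReal.rpow_le_rpow (mul_le_mul_left ?_ _) hr.le
    rw [← ENNReal.coe_mul, ENNReal.coe_le_coe]
    exact h y
  exact h1.trans_lt (by finiteness)

theorem wLpNorm_one : wLpNorm μ m 1 F = ∫⁻ x, m x * ‖F x‖ₑ ∂μ := by
  rw [wLpNorm, eLpNorm_one_eq_lintegral_enorm]
  simp only [enorm_nnreal_smul]

theorem wLpNorm_one_le {C : ℝ≥0} (h : ∀ x, m x ≤ C * v x) :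
    wLpNorm μ m 1 F ≤ C * wLpNorm μ v 1 F := by
  rw [wLpNorm_one, wLpNorm_one, ← lintegral_const_mul' _ _ (by finiteness)]
  refine lintegral_mono fun y => ?_
  rw [← mul_assoc]
  refine mul_le_mul_left ?_ _
  rw [← ENNReal.coe_mul, ENNReal.coe_le_coe]
  exact h y

theorem MemWLp.one_of_le (hm : Measurable m) (hF : Continuous F) {C : ℝ≥0}
    (h : ∀ x, m x ≤ C * v x) (hv : MemWLp μ v 1 F) : MemWLp μ m 1 F :=
  ⟨(hm.smul hF.measurable).aestronglyMeasurable,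
    (wLpNorm_one_le h).trans_lt (ENNReal.mul_lt_top ENNReal.coe_lt_top hv.2)⟩

end Weights

/-! ### Analyzing vectors and the coorbit space -/

section Coorbit

variable {G : Type*} [Group G] [TopologicalSpace G] [IsTopologicalGroup G]
  [LocallyCompactSpace G] [T2Space G] [MeasurableSpace G] [BorelSpace G]
  {μ : Measure G} [μ.IsHaarMeasure] [μ.Regular] {m v : G → ℝ≥0} {r : ℝ} {p : ℝ≥0∞} {Q : Set G}
  {H : Type*} [NormedAddCommGroup H] [InnerProductSpace ℂ H] [CompleteSpace H]
  {π : G →* (H ≃ₗᵢ[ℂ] H)} {c : ℂ}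

/-- The convolution relation for voice transforms. -/
theorem enorm_mul_voice_le
    (hc : ∀ a f b h : H, ∫ x, starRingEnd ℂ (voice π a f x) * voice π b h x ∂μ =
      c * inner ℂ f h * inner ℂ b a) (a b g h : H) (x : G) :
    ‖c * inner ℂ b a‖ₑ * ‖voice π g h x‖ₑ ≤
      ∫⁻ y, ‖voice π b h y‖ₑ * ‖voice π g a (y⁻¹ * x)‖ₑ ∂μ := by
  have h1 : c * inner ℂ b a * voice π g h x =
      ∫ y, voice π b h y * voice π g a (y⁻¹ * x) ∂μ := by
    rw [voice, mul_right_comm, ← hc a (π x g) b h]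
    refine integral_congr_ae (.of_forall fun y => ?_)
    have h2 := voice_inv π g a (x⁻¹ * y)
    rw [mul_inv_rev, inv_inv] at h2
    simp only
    rw [voice_map, ← h2, mul_comm]
  rw [← enorm_mul, h1]
  refine (enorm_integral_le_lintegral_enorm _).trans_eq ?_
  simp only [enorm_mul]

/-- This changes the analyzing vector from b to g: |V_g h| is dominated by a multiple of |V_b h| *
|V_g a|, and the constant is finite because a and b are not orthogonal. -/
theorem ampInt_voice_lt_top [μ.IsMulRightInvariant] (hπ : IsIrreducibleUnitaryRep π)
    (hc0 : c ≠ 0) (hc : ∀ a f b h : H, ∫ x, starRingEnd ℂ (voice π a f x) * voice π b h x ∂μ =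
      c * inner ℂ f h * inner ℂ b a) (hIN : IsINGroup G) (hm : IsSubmulWeight m) (hr : 0 < r)
    (hr1 : r ≤ 1) (hQ : IsWindow Q) {a b g h : H} (hba : inner ℂ b a ≠ 0)
    (h₁ : ampInt μ m r (voice π b h) Q < ∞) (h₂ : ampInt μ m r (voice π g a) Q < ∞) :
    ampInt μ m r (voice π g h) Q < ∞ := by
  have h0 : ‖c * inner ℂ b a‖ₑ ≠ 0 := by simpa using ⟨hc0, hba⟩
  refine ampInt_lt_top_of_le_convolution hIN hm hr hr1 hQ (hπ.continuous_voice b h)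
    (hπ.continuous_voice g a) (hπ.continuous_voice g h) h₁ h₂
    (c := ‖c * inner ℂ b a‖ₑ⁻¹) (ENNReal.inv_ne_top.2 h0) fun x => ?_
  rw [mul_comm, ← div_eq_mul_inv, ENNReal.le_div_iff_mul_le (.inl h0) (.inl enorm_ne_top), mul_comm]
  exact enorm_mul_voice_le hc a b g h x

/-- Compare |c| ‖g‖²‖h‖², the squared L² norm of V_g h, with its L¹ norm, using |V_g h| ≤ ‖g‖‖h‖. It
makes the norm of H¹_v dominate that of H, so vectors of H act as bounded functionals. -/
theorem enorm_le_lintegral_voice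
    (hc : ∀ a f b h : H, ∫ x, starRingEnd ℂ (voice π a f x) * voice π b h x ∂μ =
      c * inner ℂ f h * inner ℂ b a) (g h : H) :
    ‖c‖ₑ * ‖g‖ₑ * ‖h‖ₑ ≤ ∫⁻ x, ‖voice π g h x‖ₑ ∂μ := by
  by_cases hg : g = 0
  · simp [hg]
  by_cases hh : h = 0
  · simp [hh]
  have h0 : ‖g‖ₑ * ‖h‖ₑ ≠ 0 := by simp [hg, hh]
  have h1 : ‖g‖ₑ * ‖h‖ₑ ≠ ∞ := by finiteness
  refine (ENNReal.mul_le_mul_iff_right h0 h1).1 ?_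
  have hn : ∀ f : H, ‖((‖f‖ : ℝ) : ℂ)‖ₑ = ‖f‖ₑ := fun f => by simp [← ofReal_norm]
  have h2 : ‖c * inner ℂ h h * inner ℂ g g‖ₑ = ‖g‖ₑ * ‖h‖ₑ * (‖c‖ₑ * ‖g‖ₑ * ‖h‖ₑ) := by
    rw [enorm_mul, enorm_mul, inner_self_eq_norm_sq_to_K, inner_self_eq_norm_sq_to_K, enorm_pow,
      enorm_pow]
    simp only [Complex.coe_algebraMap, hn]
    ring
  rw [← h2, ← hc g h g h, ← lintegral_const_mul' _ _ h1]
  refine (enorm_integral_le_lintegral_enorm _).trans (lintegral_mono fun x => ?_)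
  rw [enorm_mul]
  refine mul_le_mul_left ?_ _
  rw [RCLike.enorm_conj]
  have := norm_voice_le π g h x
  rw [← ofReal_norm, ← ofReal_norm, ← ofReal_norm, ← ENNReal.ofReal_mul (norm_nonneg _)]
  exact ENNReal.ofReal_le_ofReal this

theorem embed_mem_antidual (hc0 : c ≠ 0)
    (hc : ∀ a f b h : H, ∫ x, starRingEnd ℂ (voice π a f x) * voice π b h x ∂μ =
      c * inner ℂ f h * inner ℂ b a) {C : ℝ≥0} (hv : ∀ x, 1 ≤ C * v x) {g₀ : H} (hg₀ : g₀ ≠ 0)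
    (u : H) : embed μ π v g₀ u ∈ antidual μ π v g₀ := by
  have h0 : ‖c‖ₑ * ‖g₀‖ₑ ≠ 0 := by simp [hc0, hg₀]
  have h1 : ‖c‖ₑ * ‖g₀‖ₑ ≠ ∞ := by finiteness
  refine ⟨(‖c‖ₑ * ‖g₀‖ₑ)⁻¹.toNNReal * C * ‖u‖₊, fun h => ?_⟩
  have h2 : ‖(h : H)‖ₑ ≤ (‖c‖ₑ * ‖g₀‖ₑ)⁻¹ * (C * wLpNorm μ v 1 (voice π g₀ (h : H))) := by
    rw [mul_comm, ← div_eq_mul_inv, ENNReal.le_div_iff_mul_le (.inl h0) (.inl h1), mul_comm]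
    refine (enorm_le_lintegral_voice hc g₀ (h : H)).trans ?_
    have := wLpNorm_one_le (μ := μ) (m := fun _ => 1) (F := voice π g₀ (h : H)) hv
    simpa [wLpNorm_one] using this
  push_cast
  rw [ENNReal.coe_toNNReal (ENNReal.inv_ne_top.2 h0)]
  calc ‖inner ℂ (h : H) u‖ₑ ≤ ‖(h : H)‖ₑ * ‖u‖ₑ := by
        rw [← ofReal_norm, ← ofReal_norm, ← ofReal_norm, ← ENNReal.ofReal_mul (norm_nonneg _)]
        exact ENNReal.ofReal_le_ofReal (norm_inner_le_norm _ _)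
    _ ≤ (‖c‖ₑ * ‖g₀‖ₑ)⁻¹ * (C * wLpNorm μ v 1 (voice π g₀ (h : H))) * ‖u‖ₑ := by gcongr
    _ = _ := by
        rw [enorm_eq_nnnorm u]
        ring

/-- Bounded functionals on `H¹_m` whose voice transform lies in `L¹_m` are represented by vectors
of the Hilbert space. -/
theorem exists_forall_functional_eq_inner (hm : IsSubmulWeight m) (hπ : IsIrreducibleUnitaryRep π)
    (hone : ∀ x, 1 ≤ m x) (hc0 : c ≠ 0)
    (hc : ∀ a f b h : H, ∫ x, starRingEnd ℂ (voice π a f x) * voice π b h x ∂μ =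
      c * inner ℂ f h * inner ℂ b a)
    {g₀ g : H} (hg₀ : g₀ ≠ 0) (hg : g ≠ 0) (hgg : MemWLp μ m 1 (voice π g g))
    (hb : MemWLp μ m 1 (voice π g₀ g)) (Λ : l1Graph μ m π g₀ →L[ℂ] ℂ)
    (hΛ : MemWLp μ m 1 fun y => starRingEnd ℂ (Λ (l1Orbit hm hπ hb y))) :
    ∃ u : H, ∀ h (hh : MemWLp μ m 1 (voice π g₀ h)),
      starRingEnd ℂ (Λ (l1GraphMk hh)) = inner ℂ h u := by
  set F : G → ℂ := fun y => starRingEnd ℂ (Λ (l1Orbit hm hπ hb y)) with hFdef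
  have hF : Continuous F :=
    Complex.continuous_conj.comp (Λ.continuous.comp (continuous_l1Orbit hone hb))
  have hF1 := (memWLp_one_iff hm.continuous.measurable hF).1 hΛ
  have hFi : Integrable F μ := by
    refine ⟨hF.aestronglyMeasurable, lt_of_le_of_lt (lintegral_mono fun x => ?_) hF1⟩
    exact le_mul_of_one_le_left zero_le (ENNReal.one_le_coe_iff.2 (hone x))
  have hint : Integrable (fun y => F y • π y g) μ := by
    refine (hFi.norm.mul_const ‖g‖).mono'
      (aestronglyMeasurable_smul_of_integrable hF hFi (hπ.strongly_continuous g))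
      (.of_forall fun y => ?_)
    simp [norm_smul]
  set k := starRingEnd ℂ (c * inner ℂ g g)
  have hk : k ≠ 0 := by simp [k, hc0, hg]
  -- The vector is the reproducing integral of F, normalized by the conjugate of c⟨g, g⟩;
  -- conjugation enters because Λ is linear while the functional it represents is conjugate-linear.
  refine ⟨k⁻¹ • ∫ y, F y • π y g ∂μ, fun h hh => ?_⟩
  have hgh : MemWLp μ m 1 (voice π g h) :=
    memWLp_voice_of_memWLp hm hπ hone hc0 hc hgg hg hh hg₀
  have key := congrArg (starRingEnd ℂ)
    (integral_voice_mul_functional (hm := hm) (hπ := hπ) hone hc hb hgh hh Λ)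
  rw [map_mul, ← integral_conj] at key
  rw [inner_smul_right, ← integral_inner hint, eq_inv_mul_iff_mul_eq₀ hk]
  refine key.symm.trans (integral_congr_ae (.of_forall fun y => ?_))
  simp only [map_mul, inner_smul_right, voice, inner_conj_symm]
  rw [mul_comm]

/-- A bounded conjugate-linear functional on `H¹_v`, as a functional on the graph that realizes
`H¹_m`. -/
theorem exists_functional_of_mem_antidual {C : ℝ≥0} (hv : ∀ x, v x ≤ C * m x) {g₀ : H}
    (hmem : ∀ h : H, MemWLp μ m 1 (voice π g₀ h) → MemWLp μ v 1 (voice π g₀ h))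
    {f : H1 μ π v g₀ →ₛₗ[starRingEnd ℂ] ℂ} (hf : f ∈ antidual μ π v g₀) :
    ∃ Λ : l1Graph μ m π g₀ →L[ℂ] ℂ, ∀ e,
      Λ e = starRingEnd ℂ (f ⟨(e : H × Lp ℂ 1 μ).1, hmem _ (memWLp_of_mem_l1Graph e)⟩) := by
  obtain ⟨D, hD⟩ := hf
  let L : l1Graph μ m π g₀ →ₗ[ℂ] ℂ :=
    { toFun := fun e => starRingEnd ℂ
        (f ⟨(e : H × Lp ℂ 1 μ).1, hmem _ (memWLp_of_mem_l1Graph e)⟩)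
      map_add' := fun a b => by
        rw [← map_add, ← map_add]
        rfl
      map_smul' := fun a b => by
        have : starRingEnd ℂ (f (a • ⟨(b : H × Lp ℂ 1 μ).1, hmem _ (memWLp_of_mem_l1Graph b)⟩)) =
            a * starRingEnd ℂ (f ⟨(b : H × Lp ℂ 1 μ).1, hmem _ (memWLp_of_mem_l1Graph b)⟩) := by
          rw [map_smulₛₗ, smul_eq_mul, map_mul, Complex.conj_conj]
        exact this }
  refine ⟨L.mkContinuous (D * C) fun e => ?_, fun e => rfl⟩
  have h1 : ‖L e‖ₑ ≤ D * (C * ‖(e : H × Lp ℂ 1 μ).2‖ₑ) := by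
    have h2 : ‖(e : H × Lp ℂ 1 μ).2‖ₑ = wLpNorm μ m 1 (voice π g₀ (e : H × Lp ℂ 1 μ).1) := by
      rw [Lp.enorm_def]
      exact eLpNorm_congr_ae e.2
    rw [h2]
    change ‖starRingEnd ℂ _‖ₑ ≤ _
    rw [RCLike.enorm_conj]
    exact (hD _).trans (mul_le_mul_right (wLpNorm_one_le hv) _)
  have h2 : ‖L e‖₊ ≤ D * (C * ‖(e : H × Lp ℂ 1 μ).2‖₊) := by
    rw [enorm_eq_nnnorm, enorm_eq_nnnorm] at h1
    exact_mod_cast h1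
  calc ‖L e‖ ≤ D * (C * ‖(e : H × Lp ℂ 1 μ).2‖) := by exact_mod_cast h2
    _ ≤ D * (C * ‖e‖) := by
        gcongr
        exact norm_snd_le (e : H × Lp ℂ 1 μ)
    _ = _ := by ring

/-- The orbit of g is contained in H¹_v and is total in H. -/
theorem embed_injective (hπ : IsIrreducibleUnitaryRep π) {g₀ g : H}
    (hg : g ≠ 0) (hmem : ∀ x, π x g ∈ H1 μ π v g₀) :
    Function.Injective (embed μ π v g₀) := by
  intro u u' huu'
  rw [← sub_eq_zero]
  refine hπ.eq_zero_of_forall_inner hg fun x => ?_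
  rw [inner_sub_right, sub_eq_zero]
  exact LinearMap.congr_fun huu' ⟨π x g, hmem x⟩

theorem norm_voice_self_inv (g : H) (x : G) : ‖voice π g g x⁻¹‖ = ‖voice π g g x‖ := by
  rw [voice_inv, RCLike.norm_conj]

theorem mem_classB_iff [μ.IsMulRightInvariant] (hπ : IsIrreducibleUnitaryRep π)
    (hm : Measurable m) (hQ : IsWindow Q) (hp0 : 0 < p) (hp1 : p ≤ 1) {g : H} :
    g ∈ classB μ π Q m p ↔
      MemLp (voice π g g) 2 μ ∧ ampInt μ m p.toReal (voice π g g) Q < ∞ :=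
  and_congr_right fun _ => memAmalgam_iff_of_continuous hm hQ hp0 hp1 (hπ.continuous_voice g g)

theorem classB_eq_classB_bullet [μ.IsMulRightInvariant] [μ.IsInvInvariant]
    (hπ : IsIrreducibleUnitaryRep π) (hIN : IsINGroup G) (hm : IsSubmulWeight m)
    (hQ : IsWindow Q) (hp0 : 0 < p) (hp1 : p ≤ 1) :
    classB μ π Q m p = classB μ π Q (bullet m) p := by
  ext g
  rw [mem_classB_iff hπ hm.continuous.measurable hQ hp0 hp1,
    mem_classB_iff hπ hm.bullet.continuous.measurable hQ hp0 hp1,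
    ampInt_bullet_lt_top_iff hIN hm (toReal_pos_of_le_one hp0 hp1) (toReal_le_one hp1) hQ
      (hπ.continuous_voice g g) (norm_voice_self_inv g)]

/-- The weights of Y are dominated by m, and the embedding of the amalgam into L¹_m supplies the
integrability required by 𝔸_v. -/
theorem classB_subset_classBY [μ.IsMulRightInvariant] (hπ : IsIrreducibleUnitaryRep π)
    (hIN : IsINGroup G) (hm : IsSubmulWeight m) (hsymm : ∀ x, m x⁻¹ = m x)
    (hone : ∀ x, 1 ≤ m x) (hQ : IsWindow Q) (hp0 : 0 < p) (hp1 : p ≤ 1) :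
    classB μ π Q m p ⊆ classBY μ π Q m p := by
  have hr := toReal_pos_of_le_one hp0 hp1
  have hr1 := toReal_le_one hp1
  obtain ⟨C, hC⟩ := exists_weight_equiv (μ := μ) hIN hm hsymm hone hp0 hp1 hQ
  intro g hg
  rw [mem_classB_iff hπ hm.continuous.measurable hQ hp0 hp1] at hg
  refine ⟨(mem_classB_iff hπ (measurable_rightWeight hIN hm hp0 hp1 hQ) hQ hp0 hp1).2
    ⟨hg.1, ampInt_lt_top_of_le hr (fun x => (hC x).2.2.2) hg.2⟩, ?_⟩
  refine MemWLp.one_of_le (measurable_leftWeight hm hp0 hp1 hQ) (hπ.continuous_voice g g)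
    (fun x => (hC x).2.1) ?_
  exact (memWLp_one_iff hm.continuous.measurable (hπ.continuous_voice g g)).2
    (lintegral_mul_enorm_lt_top hIN hm hr hr1 hQ (hπ.continuous_voice g g) hg.2)

theorem mem_classB_of_mem_classBY [μ.IsMulRightInvariant] (hπ : IsIrreducibleUnitaryRep π)
    (hIN : IsINGroup G) (hm : IsSubmulWeight m) (hsymm : ∀ x, m x⁻¹ = m x)
    (hone : ∀ x, 1 ≤ m x) (hQ : IsWindow Q) (hp0 : 0 < p) (hp1 : p ≤ 1) {g : H}
    (hg : g ∈ classBY μ π Q m p) : g ∈ classB μ π Q m p := by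
  obtain ⟨C, hC⟩ := exists_weight_equiv (μ := μ) hIN hm hsymm hone hp0 hp1 hQ
  have h1 := (mem_classB_iff hπ (measurable_rightWeight hIN hm hp0 hp1 hQ) hQ hp0 hp1).1 hg.1
  exact (mem_classB_iff hπ hm.continuous.measurable hQ hp0 hp1).2
    ⟨h1.1, ampInt_lt_top_of_le (toReal_pos_of_le_one hp0 hp1) (fun x => (hC x).2.2.1) h1.2⟩

/-- The amalgam class is the coorbit space, and `H` embeds into the anti-dual of `H¹_v`. -/
theorem embed_injective_and_image_classB [μ.IsMulRightInvariant] [μ.IsInvInvariant]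
    (hπ : IsIrreducibleUnitaryRep π) (hIN : IsINGroup G) (hm : IsSubmulWeight m)
    (hsymm : ∀ x, m x⁻¹ = m x) (hone : ∀ x, 1 ≤ m x) (hQ : IsWindow Q) (hp0 : 0 < p)
    (hp1 : p ≤ 1) {g₀ g : H} (hg₀A : g₀ ∈ classA μ π (leftWeight μ Q m p)) (hg₀ : g₀ ≠ 0)
    (hgB : g ∈ classBY μ π Q m p) (hg : g ≠ 0) :
    Function.Injective (embed μ π (leftWeight μ Q m p) g₀) ∧
      embed μ π (leftWeight μ Q m p) g₀ '' classB μ π Q m p = coorbit μ π Q m p g₀ g := by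
  have hr := toReal_pos_of_le_one hp0 hp1
  have hr1 := toReal_le_one hp1
  have hmm := hm.continuous.measurable
  obtain ⟨C, hC⟩ := exists_weight_equiv (μ := μ) hIN hm hsymm hone hp0 hp1 hQ
  set v := leftWeight μ Q m p
  have hvm : Measurable v := measurable_leftWeight hm hp0 hp1 hQ
  have hvto : ∀ a h : H, MemWLp μ m 1 (voice π a h) → MemWLp μ v 1 (voice π a h) := fun a h =>
    MemWLp.one_of_le hvm (hπ.continuous_voice a h) fun x => (hC x).2.1
  have hgcl := (mem_classB_iff hπ hmm hQ hp0 hp1).1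
    (mem_classB_of_mem_classBY hπ hIN hm hsymm hone hQ hp0 hp1 hgB)
  obtain ⟨c, hc0, horth⟩ := hπ.exists_orthogonality hg hgcl.1
  have hc := fun a f => (horth a f).2
  have hgg : MemWLp μ m 1 (voice π g g) := MemWLp.one_of_le hmm (hπ.continuous_voice g g)
    (fun x => (hC x).1) hgB.2
  have hg₀g₀ : MemWLp μ m 1 (voice π g₀ g₀) := MemWLp.one_of_le hmm (hπ.continuous_voice g₀ g₀)
    (fun x => (hC x).1) hg₀A
  have hb : MemWLp μ m 1 (voice π g₀ g) :=
    memWLp_voice_of_memWLp hm hπ hone hc0 hc hg₀g₀ hg₀ hgg hg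
  have hmem : ∀ x, π x g ∈ H1 μ π v g₀ := fun x => hvto _ _ (memWLp_voice_map hm hπ hb x)
  have hinj := embed_injective hπ hg hmem
  refine ⟨hinj, Subset.antisymm ?_ ?_⟩
  · rintro _ ⟨u, hu, rfl⟩
    have hu' := ((mem_classB_iff hπ hmm hQ hp0 hp1).1 hu).2
    refine ⟨embed_mem_antidual hc0 hc (fun x => (hone x).trans (hC x).1) hg₀ u, hmem, ?_⟩
    refine (memAmalgam_iff_of_continuous hmm hQ hp0 hp1 (hπ.continuous_voice g u)).2 ?_
    by_cases hu0 : u = 0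
    · subst hu0
      have h1 : voice π g (0 : H) = voice π (0 : H) (0 : H) := by
        ext x
        simp [voice]
      rwa [h1]
    -- As u may be orthogonal to g, a translate π(z)g serves as the intermediate vector; V_g π(z)g
    -- is a left translate of V_g g.
    obtain ⟨z, hz⟩ := hπ.exists_inner_ne_zero hg hu0
    refine ampInt_voice_lt_top hπ hc0 hc hIN hm hr hr1 hQ (a := π z g) (b := u)
      (fun h0 => hz ?_) hu' ?_
    · rw [← inner_conj_symm, h0, map_zero]
    · have h1 : voice π g (π z g) = leftTrans z (voice π g g) := by
        ext x
        exact voice_map π g g z x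
      rw [h1]
      exact (ampInt_leftTrans_le hm hr z Q).trans_lt
        (ENNReal.mul_lt_top (by finiteness) hgcl.2)
  · rintro f ⟨hf, hg', hfW⟩
    obtain ⟨Λ, hΛ⟩ := exists_functional_of_mem_antidual (fun x => (hC x).2.1) (hvto g₀) hf
    have hFeq : (fun y => starRingEnd ℂ (Λ (l1Orbit hm hπ hb y))) = fun x => f ⟨π x g, hg' x⟩ := by
      ext y
      rw [hΛ, Complex.conj_conj]
      rfl
    have hFc : Continuous fun x => f ⟨π x g, hg' x⟩ := by
      rw [← hFeq]
      exact Complex.continuous_conj.comp (Λ.continuous.comp (continuous_l1Orbit hone hb))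
    have hFW := (memAmalgam_iff_of_continuous hmm hQ hp0 hp1 hFc).1 hfW
    have hF1 := (memWLp_one_iff hmm hFc).2 (lintegral_mul_enorm_lt_top hIN hm hr hr1 hQ hFc hFW)
    obtain ⟨u, hu⟩ := exists_forall_functional_eq_inner hm hπ hone hc0 hc hg₀ hg hgg hb Λ
      (by rwa [hFeq])
    have hfu : embed μ π v g₀ u = f := by
      ext ⟨h, hh⟩
      have hh' : MemWLp μ m 1 (voice π g₀ h) :=
        MemWLp.one_of_le hmm (hπ.continuous_voice g₀ h) (fun x => (hC x).1) hh
      have := hu h hh'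
      rw [hΛ, Complex.conj_conj] at this
      exact this.symm
    refine ⟨u, (mem_classB_iff hπ hmm hQ hp0 hp1).2 ⟨(horth u u).1, ?_⟩, hfu⟩
    have hgu : ampInt μ m p.toReal (voice π g u) Q < ∞ := by
      have h1 : voice π g u = fun x => f ⟨π x g, hg' x⟩ := by
        ext x
        rw [← hfu]
        rfl
      rwa [h1]
    -- Here the symmetry of m is used: V_u g is the conjugate of V_g u composed with inversion.
    have hug : ampInt μ m p.toReal (voice π u g) Q < ∞ := by
      have h1 := ampInt_inv_lt_top hIN hm hsymm hr hr1 hQ (hπ.continuous_voice g u) hgu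
      have h2 : ∀ x, ‖voice π g u x⁻¹‖ = ‖voice π u g x‖ := fun x => by
        rw [voice_inv, RCLike.norm_conj]
      rw [ampInt] at h1 ⊢
      simpa only [localSup_congr_norm h2] using h1
    exact ampInt_voice_lt_top hπ hc0 hc hIN hm hr hr1 hQ (a := g) (b := g) (by simpa using hg)
      hgu hug

end Coorbit

end CoorbitTheory

/-! ### The main theorem -/

theorem theorem4p4
    {G : Type*} [Group G] [TopologicalSpace G] [IsTopologicalGroup G] [LocallyCompactSpace G]
    [T2Space G] [MeasurableSpace G] [BorelSpace G]
    (μ : MeasureTheory.Measure G) [μ.IsHaarMeasure] [μ.Regular]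
    (hIN : CoorbitTheory.IsINGroup G)
    {H : Type*} [NormedAddCommGroup H] [InnerProductSpace ℂ H] [CompleteSpace H]
    (π : G →* (H ≃ₗᵢ[ℂ] H)) (hπ : CoorbitTheory.IsIrreducibleUnitaryRep π)
    (Q : Set G) (hQ : CoorbitTheory.IsWindow Q)
    (w : G → ℝ≥0) (hw : CoorbitTheory.IsSubmulWeight w)
    (p : ℝ≥0∞) (hp0 : 0 < p) (hp1 : p ≤ 1)
    (hB : ∃ g ∈ CoorbitTheory.classB μ π Q w p, g ≠ 0) :
    -- the symmetrized weight is at least one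
    (∀ x, 1 ≤ CoorbitTheory.bullet w x) ∧
    -- the coorbit space of `Y = L^p_{w•}` is well defined
    (∀ x, CoorbitTheory.BoundedOnAmalgam μ Q (CoorbitTheory.bullet w) p
        (CoorbitTheory.leftTrans x) ∧
      CoorbitTheory.BoundedOnAmalgam μ Q (CoorbitTheory.bullet w) p
        (CoorbitTheory.rightTrans x)) ∧
    (∃ g ∈ CoorbitTheory.classBY μ π Q (CoorbitTheory.bullet w) p, g ≠ 0) ∧
    -- the first identity
    CoorbitTheory.classB μ π Q w p =
      CoorbitTheory.classB μ π Q (CoorbitTheory.bullet w) p ∧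
    -- the second identity, `H` being identified with a subset of the anti-dual of `H¹_v`
    (∀ g₀ ∈ CoorbitTheory.classA μ π
          (CoorbitTheory.leftWeight μ Q (CoorbitTheory.bullet w) p), g₀ ≠ 0 →
      ∀ g ∈ CoorbitTheory.classBY μ π Q (CoorbitTheory.bullet w) p, g ≠ 0 →
        Function.Injective (CoorbitTheory.embed μ π
          (CoorbitTheory.leftWeight μ Q (CoorbitTheory.bullet w) p) g₀) ∧
        CoorbitTheory.embed μ π
            (CoorbitTheory.leftWeight μ Q (CoorbitTheory.bullet w) p) g₀ ''
            CoorbitTheory.classB μ π Q (CoorbitTheory.bullet w) p =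
          CoorbitTheory.coorbit μ π Q (CoorbitTheory.bullet w) p g₀ g) := by
  have := CoorbitTheory.isMulRightInvariant_of_isINGroup μ hIN
  have := CoorbitTheory.isInvInvariant_of_isMulRightInvariant μ
  have hone := hw.one_le_bullet
  have hB' := CoorbitTheory.classB_eq_classB_bullet (μ := μ) hπ hIN hw hQ hp0 hp1
  refine ⟨hone, fun x => ⟨?_, ?_⟩, ?_, hB', fun g₀ hg₀A hg₀ g hgB hg => ?_⟩
  · exact CoorbitTheory.boundedOnAmalgam_leftTrans hw.bullet hp0 hp1 hQ x
  · exact CoorbitTheory.boundedOnAmalgam_rightTrans hIN hw.bullet hp0 hp1 hQ x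
  · obtain ⟨g, hg, hg0⟩ := hB
    exact ⟨g, CoorbitTheory.classB_subset_classBY hπ hIN hw.bullet CoorbitTheory.bullet_inv hone
      hQ hp0 hp1 (hB' ▸ hg), hg0⟩
  · exact CoorbitTheory.embed_injective_and_image_classB hπ hIN hw.bullet
      CoorbitTheory.bullet_inv hone hQ hp0 hp1 hg₀A hg₀ hgB hg
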